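/- **Setting.** Let $K\subset\mathbb{R}^3$ be a connected unbounded set which is a finite union of convex polyhedra (finite intersections of closed half-spaces) with non-empty interior; it represents the ground, the under-ground and the buildings standing on the ground. Waves propagate in the open set $\Omega=\mathbb{R}^3\setminus K$ and are reflected on $\partial K$. Let $o\in\Omega$ be the position of the source, and let $\mathbb{S}$ be the unit sphere of emission directions with its uniform probability measure $\mathcal{S}$. For $s\in\mathbb{S}$ the ray $r_s$ starts at $o$ in direction $s$, travels in straight lines in $\Omega$, and when it reaches a point in the relative interior of a face of $K$ with unit normal $\nu$, its direction $d$ becomes $d-2\langle d,\nu\rangle\nu$; it stops if it meets an edge or a vertex of $K$. For $n\ge 0$, $r_s^{(n)}\subset\Omega$ is the part of the ray strictly after its $n$-th reflection (after the emission, if $n=0$) and strictly before its $(n+1)$-th meeting with $\partial K$ (an unbounded half-line if there is none; $r^{(n)}_s=\emptyset$ if there is no $n$-th reflection), and $\vec r_s^{\,(n)}$ is its direction. A *closed surface* is a compact connected topological surface without boundary $\mathbb{M}\subset\mathbb{R}^3$, of finite area, which is an embedded $C^1$ surface near each of its points outside a set of zero area (area being the two-dimensional Hausdorff measure). Its *exterior*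 is the unbounded component of $\mathbb{R}^3\setminus\mathbb{M}$. Let $\vec m(x)$ denote its unit normal at its $C^1$ points, chosen outward everywhere or inward everywhere (at the other points $\vec m$ is arbitrary). For $s\in\mathbb{S}$ put $$q_{\pm}^{(n)}(s)=\{x\in\mathbb{M}\cap r_s^{(n)} : \pm\langle \vec r_s^{\,(n)},\vec m(x)\rangle>0\},$$ and for $S\subset\mathbb{S}$ $$\Phi_{\mathbb{M}\pm}^{(n)}(S,\mathbb{M})=\sum_{k\in\mathbb{N}\cup\{\infty\}} k\cdot\mathcal{S}\big(\{s\in S : \#q_{\pm}^{(n)}(s)=k\}\big),\qquad \Phi_{\mathbb{M}}^{(n)}=\Phi_{\mathbb{M}+}^{(n)}-\Phi_{\mathbb{M}-}^{(n)}.$$ **Statement.** Let $\mathbb{M}\subset\Omega$ be a closed surface, $S\subset\mathbb{S}$ an open set and $n\in\mathbb{N}$; if $n=0$, assume that the source $o$ lies in the exterior of $\mathbb{M}$. Then $\#q_+^{(n)}(s)=\#q_-^{(n)}(s)$ for $\mathcal{S}$-almost every $s\in\mathbb{S}$, the fluxes $\Phi_{\mathbb{M}+}^{(n)}(S,\mathbb{M})$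 and $\Phi_{\mathbb{M}-}^{(n)}(S,\mathbb{M})$ are finite, and $$\Phi_{\mathbb{M}}^{(n)}(S,\mathbb{M})=0 .$$ -/

import Mathlib

open MeasureTheory Topology Set
open scoped ENNReal

noncomputable section

namespace RayFlux

/-- Physical space `ℝ³` with its Euclidean norm. -/
abbrev Space : Type := EuclideanSpace ℝ (Fin 3)

/-- The sphere of emission directions of the antenna. -/
abbrev Directions : Type := Metric.sphere (0 : Space) 1

/-- The uniform probability measure on the sphere of directions. -/
def uniformMeasure : Measure Directions :=
  ((volume : Measure Space).toSphere univ)⁻¹ • (volume : Measure Space).toSphere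

/-! ### The urban environment -/

/-- A convex polyhedron: a finite intersection of closed half-spaces. -/
def IsConvexPolyhedron (P : Set Space) : Prop :=
  ∃ F : Finset (Space × ℝ), P = {x | ∀ h ∈ F, inner ℝ h.1 x ≤ h.2}

/-- `K` is the closed region formed by the (unbounded) ground with the under-ground and the
polyhedral buildings standing on it. The propagation space is the open set `Kᶜ`, the reflecting
polygons form `frontier K`, and `interior K` is where no wave propagates. -/
structure IsUrbanSolid (K : Set Space) : Prop where
  polyhedral : ∃ C : Finset (Set Space),
    (∀ P ∈ C, IsConvexPolyhedron P ∧ (interior P).Nonempty) ∧ K = ⋃ P ∈ C, P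
  connected : IsConnected K
  unbounded : ¬ Bornology.IsBounded K

/-! ### Rays -/

/-- Travelling from `p` in direction `d`, the solid `K` is met for the first time at time `t`. -/
def IsFirstHit (K : Set Space) (p d : Space) (t : ℝ) : Prop :=
  0 < t ∧ p + t • d ∈ K ∧ ∀ u ∈ Ioo 0 t, p + u • d ∉ K

/-- `p` lies in the relative interior of a face of `K`, with unit normal `ν` pointing out of `K`:
near `p`, the solid `K` is a half-space bounded by the plane through `p` orthogonal to `ν`. -/
def IsFaceNormal (K : Set Space) (p ν : Space) : Prop :=
  ‖ν‖ = 1 ∧ ∀ᶠ x in 𝓝 p, (x ∈ K ↔ inner ℝ (x - p) ν ≤ 0)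

/-- Specular reflection of the direction `d` on a plane with unit normal `ν`. -/
def mirror (ν d : Space) : Space := d - (2 * inner ℝ d ν) • ν

/-- `Leg K o s n p d`: the ray emitted at `o` in direction `s` undergoes at least `n` reflections
on `frontier K`; its `n`-th segment starts at `p` and has direction `d`. A ray which
meets an edge or a vertex of `K`, where there is no law of reflection, is stopped there. -/
inductive Leg (K : Set Space) (o s : Space) : ℕ → Space → Space → Prop
  | source : Leg K o s 0 o s
  | reflect {n : ℕ} {p d ν : Space} {t : ℝ} :
      Leg K o s n p d → IsFirstHit K p d t → IsFaceNormal K (p + t • d) ν →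
        Leg K o s (n + 1) (p + t • d) (mirror ν d)

/-- `x` lies on the `n`-th segment of the ray emitted at `o` in direction `s` (the segment between
the `n`-th and the `(n+1)`-th reflection), and `d` is the direction of propagation there. -/
def PassesAt (K : Set Space) (o s : Space) (n : ℕ) (x d : Space) : Prop :=
  ∃ p, Leg K o s n p d ∧ ∃ t : ℝ, 0 < t ∧ x = p + t • d ∧ ∀ u ∈ Ioc 0 t, p + u • d ∉ K

/-! ### Closed surfaces -/

/-- The exterior of a compact set: the points of its complement which lie in an
unbounded connected component of the complement. -/
def exterior (M : Set Space) : Set Space :=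
  {x | ¬ Bornology.IsBounded (connectedComponentIn Mᶜ x)}

/-- Near `x`, the set `M` is the regular `C¹` level set `f = 0`. -/
def IsLocalEquation (M : Set Space) (x : Space) (f : Space → ℝ) : Prop :=
  ContDiffAt ℝ 1 f x ∧ gradient f x ≠ 0 ∧ ∀ᶠ y in 𝓝 x, (y ∈ M ↔ f y = 0)

/-- The points of `M` near which `M` is an embedded `C¹` surface. -/
def regularPart (M : Set Space) : Set Space :=
  {x | x ∈ M ∧ ∃ f, IsLocalEquation M x f}

/-- A closed surface in `ℝ³`: a compact connected topological surface without boundary,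
of finite area, and of class `C¹` almost everywhere for the area. -/
structure IsClosedSurface (M : Set Space) : Prop where
  compact : IsCompact M
  connected : IsConnected M
  manifold : Nonempty (ChartedSpace (EuclideanSpace ℝ (Fin 2)) M)
  finite_area : Measure.hausdorffMeasure 2 M < ∞
  regular_ae : Measure.hausdorffMeasure 2 (M \ regularPart M) = 0

/-- `ν` is the outward unit normal of `M` at `x`: it is the direction of the gradient of a local
`C¹` equation of `M` which is positive exactly on the exterior side. -/
def IsOutwardNormal (M : Set Space) (x ν : Space) : Prop :=
  ‖ν‖ = 1 ∧ ∃ f, IsLocalEquation M x f ∧ gradient f x = ‖gradient f x‖ • ν ∧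
    ∀ᶠ y in 𝓝 x, (y ∈ exterior M ↔ 0 < f y)

/-- `m` is a coherent choice of the orthogonal direction of the closed surface `M` at its regular
points: it is the outward unit normal everywhere, or the inward unit normal everywhere. -/
def IsUnitNormalField (M : Set Space) (m : Space → Space) : Prop :=
  (∀ x ∈ regularPart M, IsOutwardNormal M x (m x)) ∨
    ∀ x ∈ regularPart M, IsOutwardNormal M x (-(m x))

/-! ### Fluxes

`A` is a part of a surface whose orthogonal direction at `x` is `m x`. -/

/-- The points where the `n`-th segment crosses `A` in the direction of `m`. -/
def posCrossings (K : Set Space) (o : Space) (m : Space → Space) (n : ℕ) (A : Set Space)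
    (s : Space) : Set Space :=
  {x | x ∈ A ∧ ∃ d, PassesAt K o s n x d ∧ 0 < inner ℝ d (m x)}

/-- The points where the `n`-th segment crosses `A` against the direction of `m`. -/
def negCrossings (K : Set Space) (o : Space) (m : Space → Space) (n : ℕ) (A : Set Space)
    (s : Space) : Set Space :=
  {x | x ∈ A ∧ ∃ d, PassesAt K o s n x d ∧ inner ℝ d (m x) < 0}

/-- The flux of the `n`-th segments of the rays of `S` through `A` in the direction of `m`:
the sum over `k` of `k` times the measure of the set of those `s` in `S` with `k` crossings. -/
def posFlux (K : Set Space) (o : Space) (m : Space → Space) (n : ℕ) (S : Set Directions)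
    (A : Set Space) : ℝ≥0∞ :=
  ∑' k : ℕ∞, (k : ℝ≥0∞) *
    uniformMeasure {s | s ∈ S ∧ (posCrossings K o m n A (s : Space)).encard = k}

/-- The flux of the `n`-th segments of the rays of `S` through `A` against the direction of `m`. -/
def negFlux (K : Set Space) (o : Space) (m : Space → Space) (n : ℕ) (S : Set Directions)
    (A : Set Space) : ℝ≥0∞ :=
  ∑' k : ℕ∞, (k : ℝ≥0∞) *
    uniformMeasure {s | s ∈ S ∧ (negCrossings K o m n A (s : Space)).encard = k}

/-- The signed flux; meaningful when both one-sided fluxes are finite. -/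
def signedFlux (K : Set Space) (o : Space) (m : Space → Space) (n : ℕ) (S : Set Directions)
    (A : Set Space) : ℝ :=
  (posFlux K o m n S A).toReal - (negFlux K o m n S A).toReal

end RayFlux

end

noncomputable section

namespace RayFlux

/-! ### The uniform measure on directions -/

/-! Suppose a segment of a ray meets `M` at finitely many points, all regular and transversal. Each
crossing switches between the exterior of `M` and the rest of the complement, crossings along the
outward normal being entries into the exterior. Both ends are on the exterior side: `K` is
connected, unbounded and disjoint from `M`, hence lies in the exterior; the segment starts at `o` or
on `K`, and it either ends on `K` or is a half-line with an unbounded tail free of `M`. So entries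
and exits balance (`IsGenericRay.encard_eq_of_outward`).

Almost every ray is of this kind (`ae_isGenericRay`). The faces of `K` span finitely many planes, so
reflections unfold: all `n`-th segments lie on straight rays from finitely many mirror images of the
source (`IsUrbanSolid.exists_unfolding`), and the crossings stay at distance at least some `δ > 0`
from these images. Radial projection is Lipschitz there, so the directions whose segment meets `M ∩
B` have measure at most a constant times the area of `M ∩ B`. This discards the irregular points,
and, summed over the cells of finer and finer grids, bounds the mean number of crossings by the area
of `M`. Tangential rays are discarded by a Sard argument (`volume_cone_tangencySet`).

Bounding the flux series by this mean requires the level sets of the crossing number to be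
null-measurable. This follows from semicontinuity: at a generic direction the number of crossings
cannot drop under a small perturbation. -/

open scoped Pointwise in
-- The cone over a set of diameter `r` stays close to a single unit segment, so about `3 / r` balls
-- of radius `2 * r` centred on that segment cover it. The resulting order `r ^ 2` is what a
-- comparison with two-dimensional area needs.
lemma volume_cone_le (B : Set Directions) {r : ℝ} (hr : 0 < r) (hr2 : r ≤ 2)
    (hB : ∀ x ∈ B, ∀ y ∈ B, dist x y ≤ r) :
    (volume : Measure Space) (Ioo (0 : ℝ) 1 • ((↑) '' B : Set Space)) ≤
      ENNReal.ofReal (24 * r ^ 2) * volume (Metric.ball (0 : Space) 1) := by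
  rcases B.eq_empty_or_nonempty with rfl | ⟨b, hb⟩
  · simp
  set N : ℕ := ⌊1 / r⌋₊ + 1 with hN
  have hcov : Ioo (0 : ℝ) 1 • ((↑) '' B : Set Space) ⊆
      ⋃ k ∈ Finset.range N, Metric.closedBall (((k : ℝ) * r) • (b : Space)) (2 * r) := by
    rintro _ ⟨t, ⟨ht0, ht1⟩, _, ⟨x, hx, rfl⟩, rfl⟩
    simp only [mem_iUnion, Finset.mem_range, Metric.mem_closedBall, exists_prop]
    have h1 : (⌊t / r⌋₊ : ℝ) * r ≤ t := by
      have := Nat.floor_le (div_nonneg ht0.le hr.le)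
      rwa [le_div_iff₀ hr] at this
    have h2 : t < ((⌊t / r⌋₊ : ℝ) + 1) * r := by
      have := Nat.lt_floor_add_one (t / r)
      rwa [div_lt_iff₀ hr] at this
    refine ⟨⌊t / r⌋₊, ?_, ?_⟩
    · rw [hN, Nat.lt_succ_iff]
      exact Nat.floor_mono (by gcongr)
    · set k : ℝ := (⌊t / r⌋₊ : ℝ)
      have hxb : ‖(x : Space) - b‖ ≤ r := by
        have := hB x hx b hb
        rwa [Subtype.dist_eq, dist_eq_norm] at this
      have hx1 : ‖(x : Space)‖ = 1 := by simp
      have e : t • (x : Space) - (k * r) • (b : Space) =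
          (t - k * r) • (x : Space) + (k * r) • ((x : Space) - b) := by
        module
      have hk : 0 ≤ k * r := by positivity
      change dist (t • (x : Space)) _ ≤ _
      rw [dist_eq_norm, e]
      refine (norm_add_le _ _).trans ?_
      rw [norm_smul, norm_smul, hx1, Real.norm_eq_abs, Real.norm_eq_abs, abs_of_nonneg hk,
        abs_of_nonneg (by linarith)]
      nlinarith [norm_nonneg ((x : Space) - b)]
  have hN3 : (N : ℝ) * r ≤ 3 := by
    have h1 : (⌊1 / r⌋₊ : ℝ) * r ≤ 1 := by
      have := Nat.floor_le (div_nonneg zero_le_one hr.le)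
      rwa [le_div_iff₀ hr] at this
    rw [hN]; push_cast; linarith
  calc _ ≤ volume (⋃ k ∈ Finset.range N,
        Metric.closedBall (((k : ℝ) * r) • (b : Space)) (2 * r)) := measure_mono hcov
    _ ≤ ∑ k ∈ Finset.range N, volume (Metric.closedBall (((k : ℝ) * r) • (b : Space)) (2 * r)) :=
        measure_biUnion_finset_le _ _
    _ = (N : ℝ≥0∞) * (ENNReal.ofReal ((2 * r) ^ 3) * volume (Metric.ball (0 : Space) 1)) := by
        simp_rw [Measure.addHaar_closedBall _ _ (by positivity : 0 ≤ 2 * r)]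
        simp
    _ = ENNReal.ofReal (N * (2 * r) ^ 3) * volume (Metric.ball (0 : Space) 1) := by
        rw [ENNReal.ofReal_mul (by positivity), ENNReal.ofReal_natCast, mul_assoc]
    _ ≤ _ := by
        refine mul_le_mul_left (ENNReal.ofReal_le_ofReal ?_) _
        nlinarith [mul_le_mul_of_nonneg_right hN3 (sq_nonneg r)]

lemma toSphere_univ_ne_zero : (volume : Measure Space).toSphere univ ≠ 0 := by
  simp [Real.pi_pos]

lemma toSphere_univ_ne_top : (volume : Measure Space).toSphere univ ≠ ∞ :=
  measure_ne_top _ _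

instance : IsProbabilityMeasure uniformMeasure := ⟨by
  simp only [uniformMeasure, Measure.smul_apply, smul_eq_mul]
  exact ENNReal.inv_mul_cancel toSphere_univ_ne_zero toSphere_univ_ne_top⟩

lemma uniformMeasure_le_of_dist_le (B : Set Directions) {r : ℝ} (hr : 0 < r) (hr2 : r ≤ 2)
    (hB : ∀ x ∈ B, ∀ y ∈ B, dist x y ≤ r) (hm : MeasurableSet B) :
    uniformMeasure B ≤ ENNReal.ofReal (24 * r ^ 2) := by
  simp only [uniformMeasure, Measure.smul_apply, smul_eq_mul]
  rw [Measure.toSphere_apply' _ hm, Measure.toSphere_apply_univ, mul_comm,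
    ← div_eq_mul_inv]
  refine ENNReal.div_le_of_le_mul ?_
  rw [mul_left_comm]
  gcongr
  exact volume_cone_le B hr hr2 hB

/-- A measure bounded by the squared diameter on small sets is bounded by the Hausdorff measure. The
preceding estimate wants a measurable set and a positive radius, hence the closure of `s` and a
limit of radii decreasing to the diameter, which may be zero. -/
lemma uniformMeasure_le_hausdorffMeasure (B : Set Directions) :
    uniformMeasure B ≤ 24 * Measure.hausdorffMeasure 2 B := by
  have key : (24 : ℝ≥0∞)⁻¹ • uniformMeasure ≤ Measure.hausdorffMeasure 2 := by
    refine Measure.le_hausdorffMeasure 2 _ 1 one_pos fun s hs => ?_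
    have hlt : Metric.ediam s < ∞ := hs.trans_lt ENNReal.one_lt_top
    rw [Measure.smul_apply, smul_eq_mul, mul_comm, ← div_eq_mul_inv]
    refine ENNReal.div_le_of_le_mul ?_
    have hlim : Filter.Tendsto (fun r : ℝ≥0∞ => 24 * r ^ 2) (𝓝[>] Metric.ediam s)
        (𝓝 (24 * Metric.ediam s ^ 2)) := by
      refine Filter.Tendsto.mono_left ?_ nhdsWithin_le_nhds
      exact ENNReal.Tendsto.const_mul ((ENNReal.continuous_pow 2).tendsto _) (Or.inr (by simp))
    have : (𝓝[>] Metric.ediam s).NeBot := nhdsGT_neBot_of_exists_gt ⟨∞, hlt⟩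
    have h2 : (2 : ℝ) = ((2 : ℕ) : ℝ) := by norm_num
    rw [h2, ENNReal.rpow_natCast, mul_comm]
    refine ge_of_tendsto hlim ?_
    have : Metric.ediam s < 2 := hs.trans_lt ENNReal.one_lt_two
    filter_upwards [Ioo_mem_nhdsGT this] with r hr
    have hrt : r ≠ ∞ := (hr.2.trans ENNReal.ofNat_lt_top).ne
    have hr0 : 0 < r.toReal := ENNReal.toReal_pos (bot_le.trans_lt hr.1).ne' hrt
    have hr2 : r.toReal ≤ 2 := ENNReal.toReal_le_of_le_ofReal (by norm_num) (by simpa using hr.2.le)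
    refine (measure_mono subset_closure).trans <|
      (uniformMeasure_le_of_dist_le (closure s) hr0 hr2 (fun x hx y hy => ?_)
        isClosed_closure.measurableSet).trans ?_
    · have h := Metric.edist_le_ediam_of_mem hx hy
      rw [Metric.ediam_closure] at h
      rw [← ENNReal.ofReal_le_iff_le_toReal hrt, ← edist_dist]
      exact h.trans hr.1.le
    · rw [ENNReal.ofReal_mul (by norm_num), ENNReal.ofReal_pow hr0.le, ENNReal.ofReal_toReal hrt]
      simp
  have h := key B
  rw [Measure.smul_apply, smul_eq_mul, mul_comm, ← div_eq_mul_inv] at h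
  rw [mul_comm]
  exact (ENNReal.div_le_iff (by simp) (by simp)).1 h

/-- In polar coordinates the cone is `T` times a half-line of nonzero measure, so a null cone forces
a null base. No measurability of `T` is required. -/
lemma uniformMeasure_eq_zero_of_volume_cone (T : Set Directions)
    (h : (volume : Measure Space) {y | ∃ r : ℝ, 0 < r ∧ ∃ s ∈ T, y = r • (s : Space)} = 0) :
    uniformMeasure T = 0 := by
  set ν := Measure.volumeIoiPow (Module.finrank ℝ Space - 1)
  have hmp := (volume : Measure Space).measurePreserving_homeomorphUnitSphereProd
  have hprod : ((volume : Measure Space).toSphere.prod ν) (T ×ˢ (univ : Set (Ioi (0 : ℝ)))) = 0 := by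
    have hsymm := hmp.symm (homeomorphUnitSphereProd Space).toMeasurableEquiv
    have h0 : ((volume : Measure Space).comap ((↑) : ({0}ᶜ : Set Space) → Space))
        ((homeomorphUnitSphereProd Space).symm '' (T ×ˢ univ)) = 0 := by
      rw [comap_subtype_coe_apply (measurableSet_singleton _).compl]
      refine measure_mono_null ?_ h
      rintro _ ⟨_, ⟨⟨s, r⟩, ⟨hs, -⟩, rfl⟩, rfl⟩
      exact ⟨r, r.2, s, hs, rfl⟩
    have h2 := hsymm.quasiMeasurePreserving.preimage_null h0
    refine measure_mono_null ?_ h2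
    intro x hx
    exact ⟨x, hx, rfl⟩
  rw [Measure.prod_prod] at hprod
  have hν : ν univ ≠ 0 := by
    intro h0
    have := measure_mono_null (subset_univ (Iio (⟨1, mem_Ioi.2 one_pos⟩ : Ioi (0 : ℝ)))) h0
    rw [Measure.volumeIoiPow_apply_Iio] at this
    simp at this
    linarith
  simp only [uniformMeasure, Measure.smul_apply, smul_eq_mul]
  rw [(mul_eq_zero.1 hprod).resolve_right hν, mul_zero]

/-! ### Directions tangent to a surface -/

/-- The points `x` of `M` where the line through `c` and `x` is tangent to `M`. -/
def tangencySet (M : Set Space) (c : Space) : Set Space :=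
  {x | x ∈ M ∧ ∃ f, IsLocalEquation M x f ∧ inner ℝ (gradient f x) (x - c) = 0}

lemma IsLocalEquation.hasFDerivAt {M : Set Space} {x : Space} {f : Space → ℝ}
    (h : IsLocalEquation M x f) : HasFDerivAt f (innerSL ℝ (gradient f x)) x :=
  (h.1.differentiableAt (by simp)).hasGradientAt.hasFDerivAt

lemma det_eq_zero_of_comp_eq_zero {A : Space →L[ℝ] Space} {a : Space} (ha : a ≠ 0)
    (h : ∀ v, inner ℝ a (A v) = 0) : A.det = 0 := by
  by_contra hd
  obtain ⟨v, hv⟩ := (LinearMap.equivOfDetNeZero (A : Space →ₗ[ℝ] Space) hd).surjective a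
  have : A v = a := hv
  exact ha (inner_self_eq_zero.1 (this ▸ h v))

/-- Locally, a regular surface is the image of a plane by a `C¹` map `Φ`. -/
lemma IsLocalEquation.exists_straightening {M : Set Space} {x₀ : Space} {f : Space → ℝ}
    (h : IsLocalEquation M x₀ f) :
    ∃ (g : Space) (Ψ Φ : Space → Space), g ≠ 0 ∧ ContinuousAt Ψ x₀ ∧
      (∀ᶠ x in 𝓝 x₀, Φ (Ψ x) = x ∧ (x ∈ M → inner ℝ g (Ψ x) = 0)) ∧
      ∀ᶠ w in 𝓝 (Ψ x₀), DifferentiableAt ℝ Φ w ∧ (inner ℝ g w = 0 → Φ w ∈ M) := by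
  set g := gradient f x₀ with hg
  have hg0 : g ≠ 0 := h.2.1
  have hgn : ‖g‖ ^ 2 ≠ 0 := by simpa using hg0
  -- `Ψ` replaces the coordinate of `y` along `g` by `f y`. Its derivative at `x₀` is the identity,
  -- so it has a local `C¹` inverse, which maps the plane orthogonal to `g` into `M`.
  set Ψ : Space → Space := fun y => y + ((‖g‖ ^ 2)⁻¹ * (f y - inner ℝ g y)) • g with hΨ
  have hinner : ∀ y, inner ℝ g (Ψ y) = f y := by
    intro y
    simp only [hΨ, inner_add_right, inner_smul_right, real_inner_self_eq_norm_sq]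
    field_simp
    ring
  have hcd : ContDiffAt ℝ 1 Ψ x₀ := by
    refine contDiffAt_id.add (ContDiffAt.smul (contDiffAt_const.mul (h.1.sub ?_)) contDiffAt_const)
    exact (innerSL ℝ g).contDiff.contDiffAt
  have hfd : HasFDerivAt Ψ ((ContinuousLinearEquiv.refl ℝ Space : Space ≃L[ℝ] Space) :
      Space →L[ℝ] Space) x₀ := by
    have h1 := ((h.hasFDerivAt.sub (innerSL ℝ g).hasFDerivAt).const_mul
      ((‖g‖ ^ 2)⁻¹)).smul_const g
    have h2 := (hasFDerivAt_id x₀).add h1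
    refine h2.congr_fderiv ?_
    ext v
    simp [hg]
  set e := hcd.toOpenPartialHomeomorph Ψ hfd (by simp) with he
  have hmem : x₀ ∈ e.source := hcd.mem_toOpenPartialHomeomorph_source hfd (by simp)
  have hmem' : Ψ x₀ ∈ e.target := e.map_source hmem
  have hΦ : ContDiffAt ℝ 1 e.symm (Ψ x₀) := hcd.to_localInverse hfd (by simp)
  have hΦx : e.symm (Ψ x₀) = x₀ := e.left_inv hmem
  have htend : Filter.Tendsto e.symm (𝓝 (Ψ x₀)) (𝓝 x₀) := by
    simpa [ContinuousAt, hΦx] using hΦ.continuousAt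
  refine ⟨g, Ψ, e.symm, hg0, hcd.continuousAt, ?_, ?_⟩
  · filter_upwards [e.open_source.mem_nhds hmem, h.2.2] with x hx hxM
    exact ⟨e.left_inv hx, fun hM => by rw [hinner]; exact hxM.1 hM⟩
  · filter_upwards [e.open_target.mem_nhds hmem', htend.eventually h.2.2,
      hΦ.eventually (by simp)] with w hw hwM hwd
    refine ⟨hwd.differentiableAt (by simp), fun h0 => hwM.2 ?_⟩
    rw [← hinner]
    have : Ψ (e.symm w) = w := e.right_inv hw
    rwa [this]

/-- Sard's argument. The cone is the image of `G`, where the `g`-coordinate of `v` is the scaling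
factor and the projection `π v` parametrises the surface. Over a tangency point `x`, the derivative
of `G` combines vectors tangent to `M` with `x - c`, itself tangent; its range is orthogonal to the
gradient, its determinant vanishes, and the image is null. -/
lemma exists_nhds_volume_cone_tangencySet (M : Set Space) (c x₀ : Space)
    (h₀ : x₀ ∈ tangencySet M c) :
    ∃ U ∈ 𝓝 x₀, (volume : Measure Space)
      {y | ∃ r : ℝ, ∃ x ∈ tangencySet M c ∩ U, y = r • (x - c)} = 0 := by
  obtain ⟨-, f₀, hf₀, -⟩ := h₀
  obtain ⟨g, Ψ, Φ, hg0, hΨc, hΦΨ, hΦ⟩ := hf₀.exists_straightening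
  have hU := hΦΨ.and (hΨc.eventually hΦ.eventually_nhds)
  refine ⟨_, hU, ?_⟩
  set U := {x | (Φ (Ψ x) = x ∧ (x ∈ M → inner ℝ g (Ψ x) = 0)) ∧
    ∀ᶠ w in 𝓝 (Ψ x), DifferentiableAt ℝ Φ w ∧ (inner ℝ g w = 0 → Φ w ∈ M)} with hUdef
  have hgn : ‖g‖ ^ 2 ≠ 0 := by simpa using hg0
  set π : Space →L[ℝ] Space :=
    ContinuousLinearMap.id ℝ Space - (innerSL ℝ g).smulRight ((‖g‖ ^ 2)⁻¹ • g) with hπ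
  have hπv : ∀ v, π v = v - inner ℝ g v • (‖g‖ ^ 2)⁻¹ • g := fun v => by simp [hπ]
  have hgπ : ∀ v, inner ℝ g (π v) = 0 := by
    intro v
    rw [hπv, inner_sub_right, inner_smul_right, inner_smul_right, real_inner_self_eq_norm_sq]
    field_simp
    ring
  set G : Space → Space := fun v => (innerSL ℝ g v) • (Φ (π v) - c) with hG
  set s : Set Space := {v | ∃ x ∈ tangencySet M c ∩ U, π v = Ψ x} with hs
  have hsub : {y | ∃ r : ℝ, ∃ x ∈ tangencySet M c ∩ U, y = r • (x - c)} ⊆ G '' s := by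
    rintro _ ⟨r, x, hx, rfl⟩
    have hgx : inner ℝ g (Ψ x) = 0 := hx.2.1.2 hx.1.1
    have hin : inner ℝ g (Ψ x + r • (‖g‖ ^ 2)⁻¹ • g) = r := by
      rw [inner_add_right, inner_smul_right, inner_smul_right, real_inner_self_eq_norm_sq, hgx]
      field_simp
      ring
    have hπx : π (Ψ x + r • (‖g‖ ^ 2)⁻¹ • g) = Ψ x := by
      rw [hπv, hin]; abel
    refine ⟨Ψ x + r • (‖g‖ ^ 2)⁻¹ • g, ⟨x, hx, hπx⟩, ?_⟩
    simp only [hG, innerSL_apply_apply, hπx, hin, hx.2.1.1]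
  refine measure_mono_null hsub ?_
  refine addHaar_image_eq_zero_of_det_fderivWithin_eq_zero volume
    (f' := fun v => (innerSL ℝ g v) • ((fderiv ℝ Φ (π v)).comp π) +
      (innerSL ℝ g).smulRight (Φ (π v) - c)) ?_ ?_
  · rintro v ⟨x, hx, hvx⟩
    have hd : DifferentiableAt ℝ Φ (π v) := by rw [hvx]; exact hx.2.2.self_of_nhds.1
    have h1 : HasFDerivAt (fun v => Φ (π v) - c) ((fderiv ℝ Φ (π v)).comp π) v :=
      (hd.hasFDerivAt.comp v π.hasFDerivAt).sub_const c
    exact ((innerSL ℝ g).hasFDerivAt.smul h1).hasFDerivWithinAt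
  · rintro v ⟨x, hx, hvx⟩
    obtain ⟨⟨hxM, f, hf, hfx⟩, ⟨hΦx, -⟩, hev⟩ := hx
    refine det_eq_zero_of_comp_eq_zero hf.2.1 fun k => ?_
    have hd : DifferentiableAt ℝ Φ (Ψ x) := hev.self_of_nhds.1
    have hgx : inner ℝ g (Ψ x) = 0 := by rw [← hvx]; exact hgπ v
    -- `Φ` sends the line through `Ψ x` in direction `π k` into `M`, where `f` vanishes;
    -- differentiate at `0`.
    have hzero : inner ℝ (gradient f x) (fderiv ℝ Φ (Ψ x) (π k)) = 0 := by
      have hline : HasDerivAt (fun t : ℝ => Ψ x + t • π k) (π k) 0 := by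
        simpa using ((hasDerivAt_id (0 : ℝ)).smul_const (π k)).const_add (Ψ x)
      have h1 : HasDerivAt (fun t : ℝ => Φ (Ψ x + t • π k)) (fderiv ℝ Φ (Ψ x) (π k)) 0 := by
        have hd' : HasFDerivAt Φ (fderiv ℝ Φ (Ψ x)) (Ψ x + (0 : ℝ) • π k) := by
          simpa using hd.hasFDerivAt
        exact hd'.comp_hasDerivAt 0 hline
      have hf' : HasFDerivAt f (innerSL ℝ (gradient f x)) (Φ (Ψ x + (0 : ℝ) • π k)) := by
        simpa [hΦx] using hf.hasFDerivAt
      have h2 := hf'.comp_hasDerivAt 0 h1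
      have hc : Filter.Tendsto (fun t : ℝ => Ψ x + t • π k) (𝓝 0) (𝓝 (Ψ x)) := by
        simpa using hline.continuousAt.tendsto
      have hc2 : Filter.Tendsto (fun t : ℝ => Φ (Ψ x + t • π k)) (𝓝 0) (𝓝 x) := by
        simpa [ContinuousAt, hΦx] using h1.continuousAt
      have h3 : (f ∘ fun t : ℝ => Φ (Ψ x + t • π k)) =ᶠ[𝓝 0] fun _ => 0 := by
        filter_upwards [hc.eventually hev, hc2.eventually hf.2.2] with t ht1 ht2
        refine ht2.1 (ht1.2 ?_)
        rw [inner_add_right, inner_smul_right, hgπ, hgx]; simp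
      have h4 := h2.unique ((hasDerivAt_const (0 : ℝ) (0 : ℝ)).congr_of_eventuallyEq h3)
      simpa using h4
    simp only [hvx, hΦx, add_apply, smul_apply,
      ContinuousLinearMap.comp_apply, ContinuousLinearMap.smulRight_apply, innerSL_apply_apply,
      inner_add_right, inner_smul_right, hzero, hfx]
    simp

/-- The tangency set itself may have positive area, for instance if `M` contains a piece of a cone
with apex `c`; only the cone over it is null. The local statement is globalised by a countable
subcover. -/
lemma volume_cone_tangencySet (M : Set Space) (c : Space) :
    (volume : Measure Space) {y | ∃ r : ℝ, ∃ x ∈ tangencySet M c, y = r • (x - c)} = 0 := by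
  choose! U hU hU0 using exists_nhds_volume_cone_tangencySet M c
  obtain ⟨t, hts, htc, hcov⟩ := TopologicalSpace.countable_cover_nhdsWithin
    (s := tangencySet M c) (f := U) fun x hx => mem_nhdsWithin_of_mem_nhds (hU x hx)
  refine measure_mono_null ?_ ((measure_biUnion_null_iff htc).2 fun x hx => hU0 x (hts hx))
  rintro _ ⟨r, x, hx, rfl⟩
  obtain ⟨i, hi, hxi⟩ := mem_iUnion₂.1 (hcov hx)
  exact mem_iUnion₂.2 ⟨i, hi, r, x, ⟨hx, hxi⟩, rfl⟩

/-! ### Faces of a polyhedral solid -/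

lemma IsConvexPolyhedron.isClosed {P : Set Space} (h : IsConvexPolyhedron P) : IsClosed P := by
  obtain ⟨F, rfl⟩ := h
  simp only [ofPred_forall]
  exact isClosed_biInter fun h _ => isClosed_le (by fun_prop) continuous_const

lemma IsUrbanSolid.isClosed {K : Set Space} (h : IsUrbanSolid K) : IsClosed K := by
  obtain ⟨C, hC, rfl⟩ := h.polyhedral
  exact C.finite_toSet.isClosed_biUnion fun P hP => (hC P hP).1.isClosed

/-- A point of a polyhedron is interior unless it lies on one of the bounding planes. -/
lemma exists_bounding_plane {F : Finset (Space × ℝ)} {x : Space}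
    (hx : ∀ h ∈ F, inner ℝ h.1 x ≤ h.2) (hint : ¬ ∀ᶠ y in 𝓝 x, ∀ h ∈ F, inner ℝ h.1 y ≤ h.2) :
    ∃ h ∈ F, h.1 ≠ 0 ∧ inner ℝ h.1 x = h.2 := by
  contrapose! hint
  rw [Filter.eventually_all_finset]
  intro h hh
  by_cases h0 : h.1 = 0
  · have := hx h hh
    rw [h0, inner_zero_left] at this
    exact Filter.Eventually.of_forall fun _ => by rwa [h0, inner_zero_left]
  · have hlt : inner ℝ h.1 x < h.2 := lt_of_le_of_ne (hx h hh) (hint h hh h0)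
    have hc : Continuous fun y : Space => inner ℝ h.1 y := by fun_prop
    exact (hc.continuousAt.eventually (gt_mem_nhds hlt)).mono fun y hy => le_of_lt hy

/-- The faces of a polyhedral solid are contained in finitely many planes. -/
lemma IsUrbanSolid.exists_finite_planes {K : Set Space} (h : IsUrbanSolid K) :
    ∃ H : Set (Space × ℝ), H.Finite ∧ (∀ a ∈ H, a.1 ≠ 0) ∧
      ∀ x ∈ frontier K, ∃ a ∈ H, inner ℝ a.1 x = a.2 := by
  obtain ⟨C, hC, hK⟩ := h.polyhedral
  choose! F hF using fun P hP => (hC P hP).1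
  refine ⟨⋃ P ∈ C, {a | a ∈ F P ∧ a.1 ≠ 0}, ?_, ?_, ?_⟩
  · exact C.finite_toSet.biUnion fun P _ => (F P).finite_toSet.subset fun a ha => ha.1
  · intro a ha
    obtain ⟨P, -, ha⟩ := mem_iUnion₂.1 ha
    exact ha.2
  · intro x hx
    have hxK : x ∈ K := h.isClosed.frontier_subset hx
    rw [hK] at hxK
    obtain ⟨P, hP, hxP⟩ := mem_iUnion₂.1 hxK
    have hxP' := hxP
    rw [hF P hP] at hxP'
    obtain ⟨a, ha, ha0, hax⟩ := exists_bounding_plane hxP' fun hev => hx.2 <| by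
      rw [mem_interior_iff_mem_nhds]
      filter_upwards [hev] with y hy
      rw [hK]
      refine mem_iUnion₂.2 ⟨P, hP, ?_⟩
      rw [hF P hP]
      exact hy
    exact ⟨a, mem_iUnion₂.2 ⟨P, hP, ha, ha0⟩, hax⟩

lemma IsFaceNormal.eventually_mem_frontier {K : Set Space} {p ν : Space}
    (h : IsFaceNormal K p ν) : ∀ᶠ x in 𝓝 p, inner ℝ (x - p) ν = 0 → x ∈ frontier K := by
  filter_upwards [h.2.eventually_nhds] with x hx h0
  refine ⟨subset_closure (hx.self_of_nhds.2 h0.le), fun hi => ?_⟩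
  have hi := mem_interior_iff_mem_nhds.1 hi
  have hc : Filter.Tendsto (fun t : ℝ => x + t • ν) (𝓝[>] 0) (𝓝 x) := by
    have : Continuous fun t : ℝ => x + t • ν := by fun_prop
    simpa using (this.tendsto 0).mono_left nhdsWithin_le_nhds
  have hev := (hc.eventually hx).and ((hc.eventually hi).and self_mem_nhdsWithin)
  obtain ⟨t, ht1, ht2, ht3⟩ := hev.exists
  have h1 := ht1.1 ht2
  have h2 : inner ℝ (x + t • ν - p) ν = t := by
    rw [show x + t • ν - p = (x - p) + t • ν by abel, inner_add_left, h0, real_inner_smul_left,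
      real_inner_self_eq_norm_sq, h.1]
    ring
  rw [h2] at h1
  exact absurd ht3 (not_lt.2 h1)

/-- A small step along `ν - ν'` leaves the half-space of `ν` and enters that of `ν'`, unless the two
normals agree. -/
lemma IsFaceNormal.unique {K : Set Space} {p ν ν' : Space} (h : IsFaceNormal K p ν)
    (h' : IsFaceNormal K p ν') : ν = ν' := by
  by_contra hne
  have hlt : inner ℝ ν ν' < 1 := (inner_lt_one_iff_real_of_norm_eq_one h.1 h'.1).2 hne
  have hc : Filter.Tendsto (fun t : ℝ => p + t • (ν - ν')) (𝓝[>] 0) (𝓝 p) := by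
    have : Continuous fun t : ℝ => p + t • (ν - ν') := by fun_prop
    simpa using (this.tendsto 0).mono_left nhdsWithin_le_nhds
  obtain ⟨t, ⟨ht1, ht2⟩, ht3⟩ := ((hc.eventually (h.2.and h'.2)).and self_mem_nhdsWithin).exists
  have ht : 0 < t := ht3
  rw [ht1] at ht2
  simp only [add_sub_cancel_left, real_inner_smul_left, inner_sub_left, real_inner_self_eq_norm_sq,
    h.1, h'.1, real_inner_comm ν' ν] at ht2
  have := ht2.2 (by rw [real_inner_comm] at hlt; nlinarith)
  rw [real_inner_comm] at hlt
  nlinarith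

/-- A real vector space is not a finite union of proper subspaces. Hence a single `a i` annihilates
the whole plane orthogonal to `ν`. -/
lemma exists_parallel_of_forall_orthogonal {ι : Type*} {s : Set ι} (hs : s.Finite) (a : ι → Space)
    (ν : Space) (h : ∀ v : Space, inner ℝ v ν = 0 → ∃ i ∈ s, inner ℝ (a i) v = 0) :
    ∃ i ∈ s, ∃ r : ℝ, a i = r • ν := by
  have : Finite s := hs
  have hcov : ⋃ i : s, (((innerSL ℝ (a i)).toLinearMap.ker.comap (ℝ ∙ ν)ᗮ.subtype :
      Submodule ℝ (ℝ ∙ ν)ᗮ) : Set (ℝ ∙ ν)ᗮ) = univ := by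
    refine eq_univ_of_forall fun v => ?_
    obtain ⟨i, hi, hv⟩ := h v ((Submodule.mem_orthogonal_singleton_iff_inner_left).1 v.2)
    exact mem_iUnion.2 ⟨⟨i, hi⟩, by simpa using hv⟩
  obtain ⟨i, hi⟩ := Subspace.exists_eq_top_of_iUnion_eq_univ hcov
  refine ⟨i, i.2, ?_⟩
  have hmem : a i ∈ (ℝ ∙ ν)ᗮᗮ := by
    rw [Submodule.mem_orthogonal']
    intro v hv
    have : (⟨v, hv⟩ : (ℝ ∙ ν)ᗮ) ∈ (innerSL ℝ (a i)).toLinearMap.ker.comap (ℝ ∙ ν)ᗮ.subtype :=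
      hi ▸ Submodule.mem_top
    simpa using this
  rw [Submodule.orthogonal_orthogonal] at hmem
  obtain ⟨r, hr⟩ := Submodule.mem_span_singleton.1 hmem
  exact ⟨r, hr.symm⟩

/-- The planes of the faces of a polyhedral solid, given by normal and offset, are finitely many. -/
lemma IsUrbanSolid.finite_face_planes {K : Set Space} (h : IsUrbanSolid K) :
    {a : Space × ℝ | ∃ p, IsFaceNormal K p a.1 ∧ a.2 = inner ℝ p a.1}.Finite := by
  obtain ⟨H, hHf, hH0, hH⟩ := h.exists_finite_planes
  -- A plane determines its unit normal only up to sign, so both signs are listed.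
  refine ((hHf.image fun a => (‖a.1‖⁻¹ • a.1, ‖a.1‖⁻¹ * a.2)).union
    (hHf.image fun a => (-(‖a.1‖⁻¹ • a.1), -(‖a.1‖⁻¹ * a.2)))).subset ?_
  rintro ⟨ν, b⟩ ⟨p, hp, hb⟩
  simp only at hp hb
  obtain ⟨a, ⟨haH, hap⟩, r, hr⟩ := exists_parallel_of_forall_orthogonal
    (hHf.subset (sep_subset H fun a => inner ℝ a.1 p = a.2)) Prod.fst ν fun v hv => by
      have hc : Filter.Tendsto (fun t : ℝ => p + t • v) (𝓝[>] 0) (𝓝 p) := by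
        have : Continuous fun t : ℝ => p + t • v := by fun_prop
        simpa using (this.tendsto 0).mono_left nhdsWithin_le_nhds
      have hev := hc.eventually hp.eventually_mem_frontier
      obtain ⟨ε, hε, hI⟩ := mem_nhdsGT_iff_exists_Ioo_subset.1 hev
      have hI' : ∀ t ∈ Ioo 0 ε, ∃ a ∈ H, inner ℝ a.1 (p + t • v) = a.2 := fun t ht =>
        hH _ (hI ht (by simp [real_inner_smul_left, hv]))
      choose! φ hφH hφ using hI'
      -- Pigeonhole: infinitely many points of a short segment from `p` along the face lie on
      -- finitely many planes. A plane containing two of them contains `p` and the direction `v`.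
      obtain ⟨t₁, ht₁, t₂, ht₂, hne, heq⟩ :=
        (Ioo_infinite hε).exists_ne_map_eq_of_mapsTo hφH hHf
      have e1 := hφ t₁ ht₁
      have e2 := hφ t₂ ht₂
      rw [← heq] at e2
      rw [inner_add_right, inner_smul_right] at e1 e2
      have hz : inner ℝ (φ t₁).1 v = 0 := by
        have : (t₁ - t₂) * inner ℝ (φ t₁).1 v = 0 := by linarith
        exact (mul_eq_zero.1 this).resolve_left (sub_ne_zero.2 hne)
      rw [hz] at e1
      exact ⟨φ t₁, ⟨hφH t₁ ht₁, by linarith⟩, hz⟩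
  have hr0 : r ≠ 0 := fun h0 => hH0 a haH (by simp [hr, h0])
  have hn : ‖a.1‖ = |r| := by rw [hr, norm_smul, hp.1, mul_one, Real.norm_eq_abs]
  have hb' : a.2 = r * b := by
    rw [← hap, hr, real_inner_smul_left, hb, real_inner_comm]
  rcases lt_or_gt_of_ne hr0 with hneg | hpos
  · refine Or.inr ⟨a, haH, ?_⟩
    simp only [hn, abs_of_neg hneg, hb', Prod.mk.injEq]
    rw [hr, smul_smul, ← neg_smul]
    constructor
    · rw [show -((-r)⁻¹ * r) = 1 by field_simp, one_smul]
    · field_simp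
  · refine Or.inl ⟨a, haH, ?_⟩
    simp only [hn, abs_of_pos hpos, hb', Prod.mk.injEq]
    rw [hr, smul_smul]
    constructor
    · rw [inv_mul_cancel₀ hr0, one_smul]
    · field_simp

/-! ### Legs of rays -/

lemma IsFirstHit.unique {K : Set Space} {p d : Space} {t t' : ℝ} (h : IsFirstHit K p d t)
    (h' : IsFirstHit K p d t') : t = t' := by
  rcases lt_trichotomy t t' with hlt | heq | hlt
  · exact absurd h.2.1 (h'.2.2 t ⟨h.1, hlt⟩)
  · exact heq
  · exact absurd h'.2.1 (h.2.2 t' ⟨h'.1, hlt⟩)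

lemma Leg.unique {K : Set Space} {o s : Space} {n : ℕ} {p d : Space} (h : Leg K o s n p d) :
    ∀ {p' d' : Space}, Leg K o s n p' d' → p = p' ∧ d = d' := by
  induction h with
  | source => intro p' d' h'; cases h'; exact ⟨rfl, rfl⟩
  | reflect hl ht hν ih =>
    intro p' d' h'
    cases h' with
    | reflect hl' ht' hν' =>
      obtain ⟨rfl, rfl⟩ := ih hl'
      obtain rfl := ht.unique ht'
      obtain rfl := hν.unique hν'
      exact ⟨rfl, rfl⟩

lemma Leg.start_mem {K : Set Space} {o s : Space} {n : ℕ} {p d : Space} (h : Leg K o s n p d) :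
    n = 0 ∧ p = o ∨ p ∈ K := by
  cases h with
  | source => exact Or.inl ⟨rfl, rfl⟩
  | reflect hl ht hν => exact Or.inr ht.2.1

/-- The mirror image of an unfolded ray in the plane `⟪x, a.1⟫ = a.2`. -/
def reflectUnfolding (a : Space × ℝ) (u : Space × (Space ≃ₗᵢ[ℝ] Space)) :
    Space × (Space ≃ₗᵢ[ℝ] Space) :=
  (u.1 - (2 * (inner ℝ u.1 a.1 - a.2)) • a.1, u.2.trans (ℝ ∙ a.1)ᗮ.reflection)

lemma reflection_eq_mirror {ν : Space} (hν : ‖ν‖ = 1) (d : Space) :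
    (ℝ ∙ ν)ᗮ.reflection d = mirror ν d := by
  rw [Submodule.reflection_orthogonal_apply, Submodule.reflection_singleton_apply]
  simp [mirror, hν, real_inner_comm, two_mul, add_smul, two_nsmul]

/-- Unfolding of rays: up to finitely many isometries, the `n`-th segments lie on straight rays
issued from mirror images of the source. -/
lemma IsUrbanSolid.exists_unfolding {K : Set Space} (h : IsUrbanSolid K) (o : Space) (n : ℕ) :
    ∃ A : Set (Space × (Space ≃ₗᵢ[ℝ] Space)), A.Finite ∧
      ∀ s p d, Leg K o s n p d → ∃ u ∈ A, ∃ τ : ℝ, 0 ≤ τ ∧ p = u.1 + τ • u.2 s ∧ d = u.2 s := by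
  induction n with
  | zero =>
    refine ⟨{(o, LinearIsometryEquiv.refl ℝ Space)}, finite_singleton _, fun s p d hl => ?_⟩
    cases hl
    exact ⟨_, rfl, 0, le_rfl, by simp, rfl⟩
  | succ n ih =>
    obtain ⟨A, hA, hAl⟩ := ih
    refine ⟨_, h.finite_face_planes.image2 reflectUnfolding hA, fun s p d hl => ?_⟩
    cases hl with
    | @reflect _ p d ν t hl ht hν =>
      obtain ⟨u, hu, τ, hτ, rfl, rfl⟩ := hAl _ _ _ hl
      -- The hit point lies on the mirror, so it is its own image: the reflected segment starts at
      -- parameter `τ + t` on the mirrored straight ray.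
      refine ⟨_, mem_image2_of_mem (show (ν, inner ℝ (u.1 + τ • u.2 s + t • u.2 s) ν) ∈ _ from
        ⟨_, hν, rfl⟩) hu, τ + t, by linarith [ht.1], ?_, ?_⟩
      · simp only [reflectUnfolding, LinearIsometryEquiv.trans_apply, reflection_eq_mirror hν.1,
          mirror, inner_add_left, real_inner_smul_left]
        module
      · simp only [reflectUnfolding, LinearIsometryEquiv.trans_apply, reflection_eq_mirror hν.1]

/-! ### Crossings of a surface by the segments of the rays -/

/-- The points of `M` on the `n`-th segment of the ray emitted at `o` in direction `s`. -/
def crossings (K : Set Space) (o : Space) (n : ℕ) (M : Set Space) (s : Space) : Set Space :=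
  {x | x ∈ M ∧ ∃ d, PassesAt K o s n x d}

/-- Radial projection onto the unit sphere is Lipschitz away from the origin: the change of vector
and the change of length each contribute a factor `1 / δ`. -/
lemma norm_inv_smul_sub_le {δ : ℝ} (hδ : 0 < δ) {x y : Space} (hx : δ ≤ ‖x‖) (hy : δ ≤ ‖y‖) :
    ‖‖x‖⁻¹ • x - ‖y‖⁻¹ • y‖ ≤ 2 / δ * ‖x - y‖ := by
  have hx0 : 0 < ‖x‖ := hδ.trans_le hx
  have hy0 : 0 < ‖y‖ := hδ.trans_le hy
  have e : ‖x‖⁻¹ • x - ‖y‖⁻¹ • y = ‖x‖⁻¹ • (x - y) + (‖x‖⁻¹ - ‖y‖⁻¹) • y := by module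
  have h1 : |‖x‖⁻¹ - ‖y‖⁻¹| * ‖y‖ ≤ ‖x‖⁻¹ * ‖x - y‖ := by
    rw [show ‖x‖⁻¹ - ‖y‖⁻¹ = ‖x‖⁻¹ * ‖y‖⁻¹ * (‖y‖ - ‖x‖) by field_simp, abs_mul,
      abs_of_nonneg (by positivity : 0 ≤ ‖x‖⁻¹ * ‖y‖⁻¹)]
    calc ‖x‖⁻¹ * ‖y‖⁻¹ * |‖y‖ - ‖x‖| * ‖y‖ = ‖x‖⁻¹ * |‖y‖ - ‖x‖| := by field_simp
      _ ≤ ‖x‖⁻¹ * ‖x - y‖ := by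
        gcongr
        rw [norm_sub_rev]
        exact abs_norm_sub_norm_le y x
  rw [e]
  refine (norm_add_le _ _).trans ?_
  rw [norm_smul, norm_smul, norm_inv, norm_norm, Real.norm_eq_abs]
  have h2 : ‖x‖⁻¹ ≤ δ⁻¹ := inv_anti₀ hδ hx
  calc ‖x‖⁻¹ * ‖x - y‖ + |‖x‖⁻¹ - ‖y‖⁻¹| * ‖y‖ ≤ δ⁻¹ * ‖x - y‖ + δ⁻¹ * ‖x - y‖ := by
        refine add_le_add ?_ (h1.trans ?_) <;> gcongr
    _ = 2 / δ * ‖x - y‖ := by ring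

/-- The set of directions in which a set at positive distance is seen is controlled by its area. -/
lemma uniformMeasure_visible_le (c : Space) (L : Space ≃ₗᵢ[ℝ] Space) {δ : ℝ} (hδ : 0 < δ)
    (B : Set Space) (hB : ∀ x ∈ B, δ ≤ ‖x - c‖) :
    uniformMeasure {s : Directions | ∃ τ : ℝ, 0 < τ ∧ c + τ • L s ∈ B} ≤
      24 * (ENNReal.ofReal (2 / δ) ^ (2 : ℝ) * Measure.hausdorffMeasure 2 B) := by
  refine (uniformMeasure_le_hausdorffMeasure _).trans ?_
  gcongr
  -- `g` recovers the emission direction from the point that is seen.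
  set g : Space → Space := fun x => L.symm (‖x - c‖⁻¹ • (x - c)) with hg
  have hlip : LipschitzOnWith (Real.toNNReal (2 / δ)) g B := by
    refine LipschitzOnWith.of_dist_le_mul fun x hx y hy => ?_
    rw [Real.coe_toNNReal _ (by positivity), hg]
    simp only
    rw [L.symm.dist_map, dist_eq_norm, dist_eq_norm]
    have := norm_inv_smul_sub_le hδ (hB x hx) (hB y hy)
    rwa [sub_sub_sub_cancel_right] at this
  rw [← (isometry_subtype_coe : Isometry ((↑) : Directions → Space)).hausdorffMeasure_image
    (Or.inl zero_le_two)]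
  refine (measure_mono ?_).trans (hlip.hausdorffMeasure_image_le zero_le_two)
  rintro _ ⟨s, ⟨τ, hτ, hs⟩, rfl⟩
  refine ⟨_, hs, ?_⟩
  simp only [hg, add_sub_cancel_left, norm_smul, L.norm_map, Real.norm_eq_abs, abs_of_pos hτ]
  simp [smul_smul, hτ.ne']

lemma uniformMeasure_visible_eq_zero (c : Space) (L : Space ≃ₗᵢ[ℝ] Space) (B : Set Space)
    (hB : (volume : Measure Space) {y | ∃ r : ℝ, ∃ x ∈ B, y = r • (x - c)} = 0) :
    uniformMeasure {s : Directions | ∃ τ : ℝ, 0 < τ ∧ c + τ • L s ∈ B} = 0 := by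
  refine uniformMeasure_eq_zero_of_volume_cone _ ?_
  refine measure_mono_null ?_ (L.measurePreserving.quasiMeasurePreserving.preimage_null hB)
  rintro _ ⟨r, hr, s, ⟨τ, hτ, hs⟩, rfl⟩
  refine ⟨r / τ, _, hs, ?_⟩
  rw [add_sub_cancel_left, smul_smul, div_mul_cancel₀ _ hτ.ne', map_smul]

/-- Segments start at `o` when `n = 0` and on `K` otherwise; either way in a closed set disjoint
from the compact `M`. -/
lemma exists_pos_le_dist_start {K M : Set Space} (hK : IsClosed K) (hM : IsCompact M)
    (hMK : M ⊆ Kᶜ) {o : Space} {n : ℕ} (hn : n = 0 → o ∉ M) :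
    ∃ δ : ℝ, 0 < δ ∧ ∀ s p d, Leg K o s n p d → ∀ x ∈ M, δ ≤ dist x p := by
  obtain ⟨Y, hY, hd, hYp⟩ : ∃ Y : Set Space, IsClosed Y ∧ Disjoint M Y ∧
      ∀ s p d, Leg K o s n p d → p ∈ Y := by
    by_cases h0 : n = 0
    · refine ⟨{o}, isClosed_singleton, disjoint_singleton_right.2 (hn h0), fun s p d hl => ?_⟩
      subst h0
      cases hl
      rfl
    · exact ⟨K, hK, disjoint_left.2 hMK, fun s p d hl =>
        hl.start_mem.resolve_left fun h => h0 h.1⟩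
  obtain ⟨r, hr, h⟩ := Metric.exists_pos_forall_lt_edist hM hY hd
  refine ⟨r, hr, fun s p d hl x hx => ?_⟩
  have := (h x hx p (hYp s p d hl)).le
  rw [edist_nndist, ENNReal.coe_le_coe] at this
  exact_mod_cast this

/-- Crossings seen from the mirror images of the source. -/
lemma mem_unfolded_ray {K M : Set Space} {o : Space} {n : ℕ} {δ : ℝ}
    (hδM : ∀ s p d, Leg K o s n p d → ∀ x ∈ M, δ ≤ dist x p)
    {A : Set (Space × (Space ≃ₗᵢ[ℝ] Space))}
    (hA : ∀ s p d, Leg K o s n p d → ∃ u ∈ A, ∃ τ : ℝ, 0 ≤ τ ∧ p = u.1 + τ • u.2 s ∧ d = u.2 s)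
    (s : Directions) {x d : Space} (hx : x ∈ M) (hd : PassesAt K o s n x d) :
    ∃ u ∈ A, d = u.2 s ∧ ∃ τ : ℝ, δ ≤ τ ∧ x = u.1 + τ • d := by
  obtain ⟨p, hl, t, ht, rfl, -⟩ := hd
  have hle := hδM _ _ _ hl _ hx
  obtain ⟨u, hu, τ, hτ, rfl, rfl⟩ := hA _ _ _ hl
  refine ⟨u, hu, rfl, τ + t, ?_, by module⟩
  have h1 : ‖u.2 (s : Space)‖ = 1 := by simp
  rw [dist_eq_norm, add_sub_cancel_left, norm_smul, h1, mul_one, Real.norm_eq_abs,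
    abs_of_pos ht] at hle
  linarith

/-- The directions of the rays whose `n`-th segment meets a part of `M` are controlled by the
area of this part. -/
lemma exists_uniformMeasure_crossings_le {K M : Set Space} (hK : IsUrbanSolid K)
    (hM : IsCompact M) (hMK : M ⊆ Kᶜ) {o : Space} {n : ℕ} (hn : n = 0 → o ∉ M) :
    ∃ C : ℝ≥0∞, C ≠ ∞ ∧ ∀ B : Set Space,
      uniformMeasure {s : Directions | (crossings K o n M s ∩ B).Nonempty} ≤
        C * Measure.hausdorffMeasure 2 (M ∩ B) := by
  obtain ⟨δ, hδ, hδM⟩ := exists_pos_le_dist_start hK.isClosed hM hMK hn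
  obtain ⟨A, hAf, hA⟩ := hK.exists_unfolding o n
  refine ⟨hAf.toFinset.card * (24 * ENNReal.ofReal (2 / δ) ^ (2 : ℝ)), ?_, fun B => ?_⟩
  · refine ENNReal.mul_ne_top (by simp) (ENNReal.mul_ne_top (by simp) ?_)
    exact ENNReal.rpow_ne_top_of_nonneg zero_le_two ENNReal.ofReal_ne_top
  -- A mirror image of the source may lie on `M`. Crossings are nevertheless at distance at least
  -- `δ` from it along the unfolded ray, so the part of `M` closer than `δ` can be cut away.
  have hsub : {s : Directions | (crossings K o n M s ∩ B).Nonempty} ⊆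
      ⋃ u ∈ hAf.toFinset, {s : Directions | ∃ τ : ℝ, 0 < τ ∧
        u.1 + τ • u.2 s ∈ (M ∩ B) ∩ {x | δ ≤ ‖x - u.1‖}} := by
    rintro s ⟨x, ⟨hxM, d, hd⟩, hxB⟩
    obtain ⟨u, hu, rfl, τ, hτ, rfl⟩ := mem_unfolded_ray hδM hA s hxM hd
    refine mem_iUnion₂.2 ⟨u, hAf.mem_toFinset.2 hu, τ, hδ.trans_le hτ, ⟨hxM, hxB⟩, ?_⟩
    simp [norm_smul, abs_of_pos (hδ.trans_le hτ), hτ]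
  refine (measure_mono hsub).trans <| (measure_biUnion_finset_le _ _).trans ?_
  rw [mul_assoc, mul_assoc, ← nsmul_eq_mul]
  refine Finset.sum_le_card_nsmul _ _ _ fun u _ => ?_
  refine (uniformMeasure_visible_le u.1 u.2 hδ _ fun x hx => hx.2).trans ?_
  exact mul_le_mul_right (mul_le_mul_right (measure_mono inter_subset_left) _) _

/-- Almost every ray crosses `M` at regular points only. -/
lemma ae_crossings_subset_regularPart {K M : Set Space} (hK : IsUrbanSolid K)
    (hM : IsClosedSurface M) (hMK : M ⊆ Kᶜ) {o : Space} {n : ℕ} (hn : n = 0 → o ∉ M) :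
    ∀ᵐ s : Directions ∂uniformMeasure, crossings K o n M s ⊆ regularPart M := by
  obtain ⟨C, hC, h⟩ := exists_uniformMeasure_crossings_le hK hM.compact hMK hn
  have h0 := h (regularPart M)ᶜ
  rw [← sdiff_eq, hM.regular_ae, mul_zero, nonpos_iff_eq_zero] at h0
  refine measure_mono_null ?_ h0
  intro s hs
  obtain ⟨x, hx, hxr⟩ := not_subset.1 hs
  exact ⟨x, hx, hxr⟩

/-- Almost every ray crosses `M` transversally. -/
lemma ae_crossings_transversal {K M : Set Space} (hK : IsUrbanSolid K) (hM : IsCompact M)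
    (hMK : M ⊆ Kᶜ) {o : Space} {n : ℕ} (hn : n = 0 → o ∉ M) :
    ∀ᵐ s : Directions ∂uniformMeasure, ∀ x ∈ M, ∀ d, PassesAt K o s n x d →
      ∀ f, IsLocalEquation M x f → inner ℝ d (gradient f x) ≠ 0 := by
  obtain ⟨δ, hδ, hδM⟩ := exists_pos_le_dist_start hK.isClosed hM hMK hn
  obtain ⟨A, hAf, hA⟩ := hK.exists_unfolding o n
  have h0 : ∀ u ∈ A, uniformMeasure {s : Directions | ∃ τ : ℝ, 0 < τ ∧
      u.1 + τ • u.2 s ∈ tangencySet M u.1} = 0 := fun u _ =>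
    uniformMeasure_visible_eq_zero _ _ _ (volume_cone_tangencySet M u.1)
  refine measure_mono_null ?_ ((measure_biUnion_null_iff hAf.countable).2 h0)
  intro s hs
  simp only [mem_compl_iff, mem_ofPred_eq, not_forall, not_not] at hs
  obtain ⟨x, hx, d, hd, f, hf, hfd⟩ := hs
  obtain ⟨u, hu, rfl, τ, hτ, rfl⟩ := mem_unfolded_ray hδM hA s hx hd
  refine mem_iUnion₂.2 ⟨u, hu, τ, hδ.trans_le hτ, hx, f, hf, ?_⟩
  rw [add_sub_cancel_left, inner_smul_right, real_inner_comm, hfd, mul_zero]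

/-! ### Stability of legs -/

/-- A family of rays `u ↦ P s + u • D s` leaves `K` at its origin, uniformly near `s₀`. -/
def LeavesNear (K : Set Space) (P D : Space → Space) (s₀ : Space) : Prop :=
  ∀ᶠ z : Space × ℝ in 𝓝 (s₀, 0), 0 < z.2 → P z.1 + z.2 • D z.1 ∉ K

/-- Compactness of `[0, b]` makes local avoidance of `K` uniform in time. Time `0` is covered by
`LeavesNear`, and times beyond `T s₀` are excluded by continuity of `T`; the margin `b` keeps nearby
values of `T` inside the interval. -/
lemma eventually_forall_notMem {K : Set Space} {P D : Space → Space} {s₀ : Space}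
    (hstart : LeavesNear K P D s₀) {T : Space → ℝ} (hT : ContinuousAt T s₀) {b : ℝ}
    (hb : T s₀ < b)
    (h : ∀ u₀ ∈ Ioc 0 (T s₀), ∀ᶠ z : Space × ℝ in 𝓝 (s₀, u₀),
      z.2 < T z.1 → P z.1 + z.2 • D z.1 ∉ K) :
    ∀ᶠ s in 𝓝 s₀, ∀ u, 0 < u → u < T s → P s + u • D s ∉ K := by
  have hloc : ∀ u₀ ∈ Icc 0 b, ∀ᶠ z : Space × ℝ in 𝓝 (s₀, u₀),
      0 < z.2 → z.2 < T z.1 → P z.1 + z.2 • D z.1 ∉ K := by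
    intro u₀ hu₀
    rcases hu₀.1.eq_or_lt with rfl | hpos
    · exact hstart.mono fun z hz h0 _ => hz h0
    · rcases le_or_gt u₀ (T s₀) with hle | hgt
      · exact (h u₀ ⟨hpos, hle⟩).mono fun z hz _ hlt => hz hlt
      · have hc : ContinuousAt (fun z : Space × ℝ => T z.1) (s₀, u₀) :=
          ContinuousAt.comp (f := Prod.fst) (x := (s₀, u₀)) hT continuousAt_fst
        filter_upwards [hc.eventually_lt continuousAt_snd hgt] with z hz _ hlt
        exact absurd hlt (not_lt.2 hz.le)
  have := isCompact_Icc.eventually_forall_of_forall_eventually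
    (P := fun s u => 0 < u → u < T s → P s + u • D s ∉ K) hloc
  filter_upwards [this, hT.eventually (gt_mem_nhds hb)] with s hs hsb u hu huT
  exact hs u ⟨hu.le, (huT.trans hsb).le⟩ hu huT

lemma eventually_notMem_of_notMem {K : Set Space} (hK : IsClosed K) {P D : Space → Space}
    {s₀ : Space} (hP : ContinuousAt P s₀) (hD : ContinuousAt D s₀) {u₀ : ℝ}
    (h : P s₀ + u₀ • D s₀ ∉ K) :
    ∀ᶠ z : Space × ℝ in 𝓝 (s₀, u₀), P z.1 + z.2 • D z.1 ∉ K := by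
  have hc : ContinuousAt (fun z : Space × ℝ => P z.1 + z.2 • D z.1) (s₀, u₀) :=
    (ContinuousAt.comp (f := Prod.fst) (x := (s₀, u₀)) hP continuousAt_fst).add
      (continuousAt_snd.smul
        (ContinuousAt.comp (f := Prod.fst) (x := (s₀, u₀)) hD continuousAt_fst))
  exact hc.eventually (hK.isOpen_compl.mem_nhds h)

/-- A first hit in the relative interior of a face is transversal. -/
lemma IsFirstHit.inner_neg {K : Set Space} {p d ν : Space} {t : ℝ} (h : IsFirstHit K p d t)
    (hν : IsFaceNormal K (p + t • d) ν) : inner ℝ d ν < 0 := by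
  have hc : Filter.Tendsto (fun u : ℝ => p + u • d) (𝓝[<] t) (𝓝 (p + t • d)) := by
    have : Continuous fun u : ℝ => p + u • d := by fun_prop
    exact (this.tendsto t).mono_left nhdsWithin_le_nhds
  obtain ⟨u, hu1, hu2⟩ := ((hc.eventually hν.2).and (Ioo_mem_nhdsLT h.1)).exists
  have h1 := mt hu1.2 (h.2.2 u hu2)
  rw [show p + u • d - (p + t • d) = (u - t) • d by module, real_inner_smul_left] at h1
  by_contra hn
  exact h1 (mul_nonpos_of_nonpos_of_nonneg (by linarith [hu2.2]) (not_lt.1 hn))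

/-- Legs of rays persist, and depend continuously on the direction of emission. -/
lemma Leg.exists_continuous {K : Set Space} (hK : IsClosed K) {o s₀ : Space} (ho : o ∉ K) {n : ℕ}
    {p₀ d₀ : Space} (h : Leg K o s₀ n p₀ d₀) :
    ∃ P D : Space → Space, ContinuousAt P s₀ ∧ ContinuousAt D s₀ ∧ P s₀ = p₀ ∧ D s₀ = d₀ ∧
      LeavesNear K P D s₀ ∧ ∀ᶠ s in 𝓝 s₀, Leg K o s n (P s) (D s) := by
  induction h with
  | source =>
    refine ⟨fun _ => o, id, continuousAt_const, continuousAt_id, rfl, rfl, ?_,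
      Filter.Eventually.of_forall fun s => Leg.source⟩
    exact (eventually_notMem_of_notMem hK continuousAt_const continuousAt_id
      (by simpa using ho)).mono fun z hz _ => hz
  | @reflect n p d ν t hl ht hν ih =>
    obtain ⟨P, D, hP, hD, rfl, rfl, hstart, hleg⟩ := ih
    have hneg := ht.inner_neg hν
    set q := P s₀ + t • D s₀ with hq
    -- `T s` is the time at which the perturbed ray meets the plane of the face through `q`; the
    -- denominator is nonzero near `s₀` because the hit is transversal.
    set T : Space → ℝ := fun s => inner ℝ (q - P s) ν / inner ℝ (D s) ν with hTdef
    have hDν : ContinuousAt (fun s => (inner ℝ (D s) ν : ℝ)) s₀ := hD.inner continuousAt_const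
    have hT : ContinuousAt T s₀ :=
      ((continuousAt_const.sub hP).inner continuousAt_const).div hDν hneg.ne
    have hT₀ : T s₀ = t := by
      simp only [hTdef, hq, add_sub_cancel_left, real_inner_smul_left]
      field_simp [hneg.ne]
    have hQ : ContinuousAt (fun s => P s + T s • D s) s₀ := hP.add (hT.smul hD)
    have hQ₀ : P s₀ + T s₀ • D s₀ = q := by rw [hT₀]
    have hDneg : ∀ᶠ s in 𝓝 s₀, inner ℝ (D s) ν < 0 := hDν.eventually (gt_mem_nhds hneg)
    have hTin : ∀ s, inner ℝ (D s) ν < 0 → ∀ u : ℝ,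
        inner ℝ (P s + u • D s - q) ν = (u - T s) * inner ℝ (D s) ν := by
      intro s hs u
      have : T s * inner ℝ (D s) ν = inner ℝ (q - P s) ν := div_mul_cancel₀ _ hs.ne
      rw [sub_mul, this, show P s + u • D s - q = u • D s - (q - P s) by abel, inner_sub_left,
        real_inner_smul_left]
    have hface : ∀ᶠ s in 𝓝 s₀, IsFaceNormal K (P s + T s • D s) ν := by
      have h1 : Filter.Tendsto (fun s => P s + T s • D s) (𝓝 s₀) (𝓝 q) := by
        simpa only [ContinuousAt, hQ₀] using hQ
      filter_upwards [h1.eventually hν.2.eventually_nhds, hDneg] with s hs hsn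
      refine ⟨hν.1, hs.mono fun x hx => ?_⟩
      have h0 := hTin s hsn (T s)
      rw [sub_self, zero_mul] at h0
      rw [hx, show x - q = (x - (P s + T s • D s)) + (P s + T s • D s - q) by abel,
        inner_add_left, h0, add_zero]
    have hfree : ∀ᶠ s in 𝓝 s₀, ∀ u, 0 < u → u < T s → P s + u • D s ∉ K := by
      refine eventually_forall_notMem hstart hT (lt_add_one (T s₀)) fun u₀ hu₀ => ?_
      rw [hT₀] at hu₀
      rcases hu₀.2.eq_or_lt with rfl | hlt
      -- Near the hit point `K` is exactly a half-space, which the perturbed ray enters only at time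
      -- `T s`.
      · have hc : ContinuousAt (fun z : Space × ℝ => P z.1 + z.2 • D z.1) (s₀, u₀) :=
          (ContinuousAt.comp (f := Prod.fst) (x := (s₀, u₀)) hP continuousAt_fst).add
            (continuousAt_snd.smul
              (ContinuousAt.comp (f := Prod.fst) (x := (s₀, u₀)) hD continuousAt_fst))
        have hDneg' : ∀ᶠ z : Space × ℝ in 𝓝 (s₀, u₀), inner ℝ (D z.1) ν < 0 :=
          (continuousAt_fst (p := (s₀, u₀))).eventually hDneg
        filter_upwards [hc.eventually hν.2, hDneg'] with z hz hzn hzT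
        rw [hz, hTin _ hzn, not_le]
        exact mul_pos_of_neg_of_neg (by linarith) hzn
      · exact (eventually_notMem_of_notMem hK hP hD (ht.2.2 u₀ ⟨hu₀.1, hlt⟩)).mono fun z hz _ => hz
    refine ⟨fun s => P s + T s • D s, fun s => mirror ν (D s), hQ, ?_, hQ₀, rfl, ?_, ?_⟩
    · exact hD.sub ((continuousAt_const.mul hDν).smul continuousAt_const)
    · have hD' : ContinuousAt (fun s => mirror ν (D s)) s₀ :=
        hD.sub ((continuousAt_const.mul hDν).smul continuousAt_const)
      have hc : ContinuousAt (fun z : Space × ℝ => P z.1 + T z.1 • D z.1 + z.2 • mirror ν (D z.1))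
          (s₀, 0) :=
        (ContinuousAt.comp (f := Prod.fst) (x := (s₀, (0 : ℝ))) hQ continuousAt_fst).add
          (continuousAt_snd.smul
            (ContinuousAt.comp (f := Prod.fst) (x := (s₀, (0 : ℝ))) hD' continuousAt_fst))
      have hc' : Filter.Tendsto
          (fun z : Space × ℝ => P z.1 + T z.1 • D z.1 + z.2 • mirror ν (D z.1))
          (𝓝 (s₀, 0)) (𝓝 q) := by
        have := hc.tendsto
        simpa only [hQ₀, zero_smul, add_zero] using this
      have hDneg' : ∀ᶠ z : Space × ℝ in 𝓝 (s₀, (0 : ℝ)), inner ℝ (D z.1) ν < 0 :=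
        (continuousAt_fst (p := (s₀, (0 : ℝ)))).eventually hDneg
      filter_upwards [hc'.eventually hν.2, hDneg'] with z hz hzn hz0
      have h0 := hTin z.1 hzn (T z.1)
      have hm : inner ℝ (mirror ν (D z.1)) ν = - inner ℝ (D z.1) ν := by
        simp only [mirror, inner_sub_left, real_inner_smul_left, real_inner_self_eq_norm_sq, hν.1]
        ring
      rw [hz, add_sub_right_comm, inner_add_left, h0, real_inner_smul_left, hm, not_le]
      nlinarith
    · filter_upwards [hleg, hface, hfree, hT.eventually (lt_mem_nhds (hT₀ ▸ ht.1 : 0 < T s₀))]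
        with s h1 h2 h3 h4
      refine Leg.reflect h1 ⟨h4, ?_, fun u hu => h3 u hu.1 hu.2⟩ h2
      exact h2.2.self_of_nhds.2 (by simp)

/-! ### The two sides of a closed surface -/

lemma exterior_subset_compl (M : Set Space) : exterior M ⊆ Mᶜ := by
  intro x hx
  by_contra h
  refine hx ?_
  rw [connectedComponentIn_eq_empty h]
  exact Bornology.isBounded_empty

lemma mem_exterior_iff_of_mem {M : Set Space} {x y : Space}
    (h : y ∈ connectedComponentIn Mᶜ x) : y ∈ exterior M ↔ x ∈ exterior M := by
  simp only [exterior, mem_ofPred_eq, connectedComponentIn_eq h]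

lemma connectedComponentIn_mem_nhds {M : Set Space} (hM : IsClosed M) {x : Space} (hx : x ∉ M) :
    connectedComponentIn Mᶜ x ∈ 𝓝 x :=
  hM.isOpen_compl.connectedComponentIn.mem_nhds (mem_connectedComponentIn hx)

lemma isOpen_exterior {M : Set Space} (hM : IsClosed M) : IsOpen (exterior M) :=
  isOpen_iff_mem_nhds.2 fun x hx => by
    filter_upwards [connectedComponentIn_mem_nhds hM (exterior_subset_compl M hx)] with y hy
    exact (mem_exterior_iff_of_mem hy).2 hx

lemma isOpen_compl_diff_exterior {M : Set Space} (hM : IsClosed M) :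
    IsOpen (Mᶜ \ exterior M) :=
  isOpen_iff_mem_nhds.2 fun x hx => by
    filter_upwards [connectedComponentIn_mem_nhds hM hx.1] with y hy
    exact ⟨connectedComponentIn_subset _ _ hy, fun h => hx.2 ((mem_exterior_iff_of_mem hy).1 h)⟩

/-- Applied to `K` itself and to the tail of an unbounded last segment. -/
lemma subset_exterior_of_isPreconnected {M C : Set Space} (hC : IsPreconnected C) (hCM : C ⊆ Mᶜ)
    (hb : ¬ Bornology.IsBounded C) : C ⊆ exterior M := fun _ hx h =>
  hb (h.subset (hC.subset_connectedComponentIn hx hCM))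

/-- The exterior and the rest of the complement are disjoint open sets, so a connected set cannot
pass from one to the other without meeting `M`. -/
lemma inter_nonempty_of_isPreconnected {M C : Set Space} (hM : IsClosed M)
    (hC : IsPreconnected C) (h₁ : (C ∩ exterior M).Nonempty)
    (h₂ : (C ∩ (Mᶜ \ exterior M)).Nonempty) : (C ∩ M).Nonempty := by
  by_contra h
  have hsub : C ⊆ exterior M ∪ (Mᶜ \ exterior M) := by
    rw [union_sdiff_cancel (exterior_subset_compl M)]
    exact fun x hx hxM => h ⟨x, hx, hxM⟩
  obtain ⟨x, -, hx⟩ := hC _ _ (isOpen_exterior hM) (isOpen_compl_diff_exterior hM) hsub h₁ h₂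
  exact hx.2.2 hx.1

/-- Moving across `M` along its outward normal leads from the inside to the exterior. -/
lemma IsOutwardNormal.sides {M : Set Space} {x ν d : Space} (hxM : x ∈ M)
    (h : IsOutwardNormal M x ν) (hd : 0 < inner ℝ d ν) :
    (∀ᶠ t : ℝ in 𝓝[>] 0, x + t • d ∈ exterior M) ∧
      ∀ᶠ t : ℝ in 𝓝[<] 0, x + t • d ∈ Mᶜ \ exterior M := by
  obtain ⟨-, f, hf, hg, hext⟩ := h
  have hline : HasDerivAt (fun t : ℝ => x + t • d) d 0 := by
    simpa using ((hasDerivAt_id (0 : ℝ)).smul_const d).const_add x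
  have hf' : HasFDerivAt f (innerSL ℝ (gradient f x)) (x + (0 : ℝ) • d) := by
    simpa using hf.hasFDerivAt
  have hder : HasDerivAt (fun t : ℝ => f (x + t • d)) (inner ℝ (gradient f x) d) 0 :=
    HasFDerivAt.comp_hasDerivAt (f := fun t : ℝ => x + t • d) (0 : ℝ) hf' hline
  have hpos : 0 < inner ℝ (gradient f x) d := by
    rw [hg, real_inner_smul_left, real_inner_comm]
    exact mul_pos (norm_pos_iff.2 hf.2.1) hd
  have hc : Filter.Tendsto (fun t : ℝ => x + t • d) (𝓝 0) (𝓝 x) := by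
    simpa using hline.continuousAt.tendsto
  have h0 : f x = 0 := hf.2.2.self_of_nhds.1 hxM
  have hslope := hasDerivAt_iff_tendsto_slope.1 hder
  have hev : ∀ᶠ t : ℝ in 𝓝[≠] 0, 0 < slope (fun t : ℝ => f (x + t • d)) 0 t :=
    hslope.eventually (lt_mem_nhds hpos)
  have hs : ∀ t : ℝ, slope (fun t : ℝ => f (x + t • d)) 0 t = t⁻¹ * f (x + t • d) := by
    intro t; simp [slope, h0]
  simp only [hs] at hev
  constructor
  · filter_upwards [nhdsWithin_le_nhds (hc.eventually hext), self_mem_nhdsWithin,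
      nhdsWithin_mono _ (fun t ht => ne_of_gt ht) hev] with t h1 h2 h3
    exact h1.2 ((pos_iff_pos_of_mul_pos h3).1 (inv_pos.2 h2))
  · filter_upwards [nhdsWithin_le_nhds (hc.eventually hext), self_mem_nhdsWithin,
      nhdsWithin_le_nhds (hc.eventually hf.2.2),
      nhdsWithin_mono _ (fun t ht => ne_of_lt ht) hev] with t h1 h2 h3 h4
    have hneg : f (x + t • d) < 0 := by
      by_contra hn
      exact absurd h4 (not_lt.2 (mul_nonpos_of_nonpos_of_nonneg (inv_nonpos.2 (le_of_lt h2))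
        (not_lt.1 hn)))
    exact ⟨fun hM => hneg.ne (h3.1 hM), fun he => absurd (h1.1 he) (not_lt.2 hneg.le)⟩


/-! ### Counting crossings -/

/-- Along an interval, a set with finitely many boundary points, each of which is either an entry
(in `P`) or an exit (in `N`), and which contains both ends, has as many entries as exits. -/
lemma card_entries_eq_card_exits {J e : Set ℝ} (hJ : IsPreconnected J) (P N : Finset ℝ)
    (hP : ∀ t ∈ P, t ∉ e ∧ (∀ᶠ u in 𝓝[<] t, u ∉ e) ∧ ∀ᶠ u in 𝓝[>] t, u ∈ e)
    (hN : ∀ t ∈ N, t ∉ e ∧ (∀ᶠ u in 𝓝[<] t, u ∈ e) ∧ ∀ᶠ u in 𝓝[>] t, u ∉ e)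
    (hO : ∀ t ∈ J, t ∉ P → t ∉ N → (∀ᶠ u in 𝓝 t, u ∈ e) ∨ ∀ᶠ u in 𝓝 t, u ∉ e)
    {a b : ℝ} (haJ : a ∈ J) (hbJ : b ∈ J) (hae : a ∈ e) (hbe : b ∈ e)
    (haP : ∀ t ∈ P, a < t) (haN : ∀ t ∈ N, a < t) (hbP : ∀ t ∈ P, t < b) (hbN : ∀ t ∈ N, t < b) :
    P.card = N.card := by
  classical
  -- `h` is locally constant. Entry and exit times are both outside `e`, so the indicator jumps just
  -- after an entry but already at an exit; this dictates `<` for `P` and `≤` for `N`. Comparing `h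
  -- a = 1` with `h b = 1 - P.card + N.card` gives the claim.
  set h : ℝ → ℤ := fun t => (if t ∈ e then 1 else 0) - ((P.filter (· < t)).card : ℤ) +
    ((N.filter (· ≤ t)).card : ℤ) with hh
  have hle : ∀ (F : Finset ℝ) (t : ℝ), ((F.filter (· ≤ t)).card : ℤ) =
      (F.filter (· < t)).card + if t ∈ F then 1 else 0 := by
    intro F t
    have e1 : F.filter (· ≤ t) = F.filter (· < t) ∪ F.filter (· = t) := by
      ext c; simp only [Finset.mem_filter, Finset.mem_union, le_iff_lt_or_eq]; tauto
    have hd : Disjoint (F.filter (· < t)) (F.filter (· = t)) :=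
      Finset.disjoint_filter.2 fun c _ h1 h2 => h1.ne h2
    rw [e1, Finset.card_union_of_disjoint hd, Finset.filter_eq']
    split_ifs <;> simp
  have hleft : ∀ (F : Finset ℝ) (t : ℝ), ∀ᶠ u in 𝓝[<] t,
      F.filter (· < u) = F.filter (· < t) ∧ F.filter (· ≤ u) = F.filter (· < t) := by
    intro F t
    have h1 : ∀ᶠ u in 𝓝[<] t, ∀ c ∈ F, c < t → c < u := by
      rw [Filter.eventually_all_finset]
      intro c _
      by_cases hc : c < t
      · exact nhdsWithin_le_nhds ((lt_mem_nhds hc).mono fun u hu _ => hu)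
      · exact Filter.Eventually.of_forall fun u hc' => absurd hc' hc
    filter_upwards [h1, self_mem_nhdsWithin] with u hu hut
    exact ⟨Finset.filter_congr fun c hc => ⟨fun h => h.trans hut, hu c hc⟩,
      Finset.filter_congr fun c hc => ⟨fun h => h.trans_lt hut, fun h => (hu c hc h).le⟩⟩
  have hright : ∀ (F : Finset ℝ) (t : ℝ), ∀ᶠ u in 𝓝[>] t,
      F.filter (· < u) = F.filter (· ≤ t) ∧ F.filter (· ≤ u) = F.filter (· ≤ t) := by
    intro F t
    have h1 : ∀ᶠ u in 𝓝[>] t, ∀ c ∈ F, t < c → u < c := by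
      rw [Filter.eventually_all_finset]
      intro c _
      by_cases hc : t < c
      · exact nhdsWithin_le_nhds ((gt_mem_nhds hc).mono fun u hu _ => hu)
      · exact Filter.Eventually.of_forall fun u hc' => absurd hc' hc
    filter_upwards [h1, self_mem_nhdsWithin] with u hu hut
    exact ⟨Finset.filter_congr fun c hc => ⟨fun h => not_lt.1 fun h' => (hu c hc h').not_gt h,
        fun h => h.trans_lt hut⟩,
      Finset.filter_congr fun c hc => ⟨fun h => not_lt.1 fun h' => (hu c hc h').not_ge h,
        fun h => h.trans (le_of_lt hut)⟩⟩
  have hcont : ContinuousOn h J := by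
    intro t ht
    refine ContinuousAt.continuousWithinAt ?_
    refine (continuousAt_const (y := h t)).congr ?_
    have hsides : (∀ᶠ u in 𝓝[<] t, (if u ∈ e then (1 : ℤ) else 0) =
          (if t ∈ e then 1 else 0) + if t ∈ N then 1 else 0) ∧
        ∀ᶠ u in 𝓝[>] t, (if u ∈ e then (1 : ℤ) else 0) =
          (if t ∈ e then 1 else 0) + if t ∈ P then 1 else 0 := by
      by_cases htP : t ∈ P
      · obtain ⟨h1, h2, h3⟩ := hP t htP
        have htN : t ∉ N := fun htN => by
          obtain ⟨u, hu, hu'⟩ := (h3.and (hN t htN).2.2).exists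
          exact hu' hu
        simp only [h1, htP, htN, if_true, if_false]
        exact ⟨h2.mono fun u hu => by simp [hu], h3.mono fun u hu => by simp [hu]⟩
      · by_cases htN : t ∈ N
        · obtain ⟨h1, h2, h3⟩ := hN t htN
          simp only [h1, htP, htN, if_true, if_false]
          exact ⟨h2.mono fun u hu => by simp [hu], h3.mono fun u hu => by simp [hu]⟩
        · simp only [htP, htN, if_false, add_zero]
          rcases hO t ht htP htN with h1 | h1
          · have := h1.self_of_nhds
            exact ⟨nhdsWithin_le_nhds (h1.mono fun u hu => by simp [hu, this]),
              nhdsWithin_le_nhds (h1.mono fun u hu => by simp [hu, this])⟩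
          · have := h1.self_of_nhds
            exact ⟨nhdsWithin_le_nhds (h1.mono fun u hu => by simp [hu, this]),
              nhdsWithin_le_nhds (h1.mono fun u hu => by simp [hu, this])⟩
    change ∀ᶠ u in 𝓝 t, h t = h u
    rw [← nhdsNE_sup_pure, ← nhdsLT_sup_nhdsGT, Filter.eventually_sup, Filter.eventually_sup]
    refine ⟨⟨?_, ?_⟩, by simp⟩
    · filter_upwards [hsides.1, hleft P t, hleft N t] with u h1 h2 h3
      simp only [hh, h1, h2.1, h3.2, hle N t]
      ring
    · filter_upwards [hsides.2, hright P t, hright N t] with u h1 h2 h3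
      simp only [hh, h1, h2.1, h3.2, hle P t]
      ring
  have hab := hJ.constant hcont haJ hbJ
  have f1 : P.filter (· < a) = ∅ := Finset.filter_false_of_mem fun c hc => (haP c hc).not_gt
  have f2 : N.filter (· ≤ a) = ∅ := Finset.filter_false_of_mem fun c hc => (haN c hc).not_ge
  have f3 : P.filter (· < b) = P := Finset.filter_true_of_mem fun c hc => hbP c hc
  have f4 : N.filter (· ≤ b) = N := Finset.filter_true_of_mem fun c hc => (hbN c hc).le
  simp only [hh, hae, hbe, f1, f2, f3, f4, if_true, Finset.card_empty] at hab
  push_cast at hab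
  omega

/-- A ray is generic if its `n`-th segment crosses `M` at finitely many points, all of them
regular and transversal. -/
structure IsGenericRay (K : Set Space) (o : Space) (n : ℕ) (M : Set Space) (s : Space) : Prop where
  finite : (crossings K o n M s).Finite
  regular : crossings K o n M s ⊆ regularPart M
  transversal : ∀ x ∈ M, ∀ d, PassesAt K o s n x d →
    ∀ f, IsLocalEquation M x f → inner ℝ d (gradient f x) ≠ 0

lemma IsOutwardNormal.inner_ne_zero {M : Set Space} {x ν d : Space} (h : IsOutwardNormal M x ν)
    (hd : ∀ f, IsLocalEquation M x f → inner ℝ d (gradient f x) ≠ 0) : inner ℝ d ν ≠ 0 := by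
  obtain ⟨-, f, hf, hg, -⟩ := h
  intro h0
  refine hd f hf ?_
  rw [hg, inner_smul_right, h0, mul_zero]

lemma IsOutwardNormal.sides_of_neg {M : Set Space} {x ν d : Space} (hxM : x ∈ M)
    (h : IsOutwardNormal M x ν) (hd : inner ℝ d ν < 0) :
    (∀ᶠ t : ℝ in 𝓝[>] 0, x + t • d ∈ Mᶜ \ exterior M) ∧
      ∀ᶠ t : ℝ in 𝓝[<] 0, x + t • d ∈ exterior M := by
  obtain ⟨h1, h2⟩ := h.sides hxM (d := -d) (by rw [inner_neg_left]; linarith)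
  have t1 : Filter.Tendsto (fun t : ℝ => -t) (𝓝[>] 0) (𝓝[<] 0) := by
    simpa using tendsto_neg_nhdsGT (a := (0 : ℝ))
  have t2 : Filter.Tendsto (fun t : ℝ => -t) (𝓝[<] 0) (𝓝[>] 0) := by
    simpa using tendsto_neg_nhdsLT (a := (0 : ℝ))
  exact ⟨(t1.eventually h2).mono fun t ht => by simpa using ht,
    (t2.eventually h1).mono fun t ht => by simpa using ht⟩

lemma Leg.norm_direction {K : Set Space} {o s : Space} {n : ℕ} {p d : Space}
    (h : Leg K o s n p d) : ‖d‖ = ‖s‖ := by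
  induction h with
  | source => rfl
  | reflect _ _ hν ih => rw [← reflection_eq_mirror hν.1, LinearIsometryEquiv.norm_map, ih]

/-- The times at which a ray is on its segment starting at `p` in direction `d`. -/
def freeTimes (K : Set Space) (p d : Space) : Set ℝ :=
  {t | 0 < t ∧ ∀ u ∈ Ioc 0 t, p + u • d ∉ K}

lemma mem_freeTimes_of_le {K : Set Space} {p d : Space} {t u : ℝ} (ht : t ∈ freeTimes K p d)
    (hu : 0 < u) (hut : u ≤ t) : u ∈ freeTimes K p d :=
  ⟨hu, fun v hv => ht.2 v ⟨hv.1, hv.2.trans hut⟩⟩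

lemma isPreconnected_freeTimes (K : Set Space) (p d : Space) :
    IsPreconnected (freeTimes K p d) := by
  refine OrdConnected.isPreconnected ⟨fun x hx y hy z hz => ?_⟩
  exact mem_freeTimes_of_le hy (hx.1.trans_le hz.1) hz.2

lemma isOpen_freeTimes {K : Set Space} (hK : IsClosed K) (p d : Space) :
    IsOpen (freeTimes K p d) := by
  refine isOpen_iff_mem_nhds.2 fun t ht => ?_
  have hc : Continuous fun u : ℝ => p + u • d := by fun_prop
  have hev : ∀ᶠ u in 𝓝 t, p + u • d ∉ K :=
    hc.continuousAt.eventually (hK.isOpen_compl.mem_nhds (ht.2 t ⟨ht.1, le_rfl⟩))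
  obtain ⟨l, r, ⟨hl, hr⟩, hI⟩ := mem_nhds_iff_exists_Ioo_subset.1 hev
  filter_upwards [lt_mem_nhds ht.1, Ioo_mem_nhds hl hr] with u hu hur
  refine ⟨hu, fun v hv => ?_⟩
  rcases le_or_gt v t with hvt | hvt
  · exact ht.2 v ⟨hv.1, hvt⟩
  · exact hI ⟨hl.trans hvt, hv.2.trans_lt hur.2⟩

/-- A segment of a ray ends in the exterior of a surface which does not meet `K`. -/
lemma exists_late_exterior_time {K M : Set Space} (hK : IsClosed K) (hM : IsClosed M)
    (hKext : K ⊆ exterior M) {p d : Space} (hd : d ≠ 0) {t₁ : ℝ} (ht₁ : t₁ ∈ freeTimes K p d)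
    (hfin : {t | t ∈ freeTimes K p d ∧ p + t • d ∈ M}.Finite) :
    ∃ b ∈ freeTimes K p d, p + b • d ∈ exterior M ∧
      ∀ t ∈ freeTimes K p d, p + t • d ∈ M → t < b := by
  have hc : Continuous fun u : ℝ => p + u • d := by fun_prop
  -- In the bounded case the segment ends on `K`, which is exterior. In the unbounded case the
  -- half-line after the last crossing is connected, unbounded and free of `M`.
  by_cases hbdd : BddAbove (freeTimes K p d)
  · set T := sSup (freeTimes K p d) with hT
    have hlt : ∀ t ∈ freeTimes K p d, t < T := fun t ht => by
      obtain ⟨t', ht', hlt⟩ := ((((isOpen_freeTimes hK p d).eventually_mem ht).filter_mono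
        (nhdsWithin_le_nhds (s := Ioi t))).and self_mem_nhdsWithin).exists
      exact lt_of_lt_of_le hlt (le_csSup hbdd ht')
    have hbelow : ∀ u, 0 < u → u < T → u ∈ freeTimes K p d := fun u hu huT => by
      obtain ⟨t, ht, hut⟩ := exists_lt_of_lt_csSup ⟨t₁, ht₁⟩ huT
      exact mem_freeTimes_of_le ht hu hut.le
    have hT0 : 0 < T := ht₁.1.trans (hlt t₁ ht₁)
    have hTK : p + T • d ∈ K := by
      by_contra hn
      refine (hlt T ⟨hT0, fun u hu => ?_⟩).false
      rcases hu.2.eq_or_lt with rfl | h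
      · exact hn
      · exact (hbelow u hu.1 h).2 u ⟨hu.1, le_rfl⟩
    have h1 : ∀ᶠ u in 𝓝[<] T, p + u • d ∈ exterior M := nhdsWithin_le_nhds
      (hc.continuousAt.eventually ((isOpen_exterior hM).mem_nhds (hKext hTK)))
    have h2 : ∀ᶠ u in 𝓝[<] T, ∀ t ∈ {t | t ∈ freeTimes K p d ∧ p + t • d ∈ M}, t < u :=
      (Filter.eventually_all_finite hfin).2 fun t ht =>
        nhdsWithin_le_nhds (lt_mem_nhds (hlt t ht.1))
    obtain ⟨b, hb1, hb2, hb3⟩ := (h1.and (h2.and (Ioo_mem_nhdsLT hT0))).exists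
    exact ⟨b, hbelow b hb3.1 hb3.2, hb1, fun t ht htM => hb2 t ⟨ht, htM⟩⟩
  · have hall : ∀ u, 0 < u → u ∈ freeTimes K p d := fun u hu => by
      obtain ⟨t, ht, hut⟩ := not_bddAbove_iff.1 hbdd u
      exact mem_freeTimes_of_le ht hu hut.le
    obtain ⟨T, hT⟩ := hfin.bddAbove
    set T' := max T 0 with hT'
    have hfree : ∀ t, T' < t → p + t • d ∉ M := fun t ht htM =>
      (le_max_left T 0).not_gt (ht.trans_le (hT ⟨hall t ((le_max_right _ _).trans_lt ht), htM⟩))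
    have hsub : (fun u : ℝ => p + u • d) '' Ioi T' ⊆ exterior M := by
      refine subset_exterior_of_isPreconnected (isPreconnected_Ioi.image _ hc.continuousOn) ?_ ?_
      · rintro _ ⟨t, ht, rfl⟩
        exact hfree t ht
      · intro hb
        obtain ⟨R, hR⟩ := hb.subset_closedBall 0
        have hd0 : 0 < ‖d‖ := norm_pos_iff.2 hd
        set t := max (T' + 1) ((R + ‖p‖ + 1) / ‖d‖) with ht
        have h1 := hR ⟨t, (lt_add_one T').trans_le (le_max_left _ _), rfl⟩
        have h2 : R + ‖p‖ + 1 ≤ t * ‖d‖ := (div_le_iff₀ hd0).1 (le_max_right _ _)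
        have ht0 : 0 ≤ t := ((le_max_right T 0).trans (by linarith)).trans (le_max_left _ _)
        rw [mem_closedBall_zero_iff] at h1
        have h3 := norm_sub_le (p + t • d) p
        rw [add_sub_cancel_left, norm_smul, Real.norm_eq_abs, abs_of_nonneg ht0] at h3
        linarith
    refine ⟨T' + 1, hall _ (by linarith [le_max_right T 0]), hsub ⟨T' + 1, lt_add_one T', rfl⟩, ?_⟩
    intro t ht htM
    exact lt_of_le_of_lt ((hT ⟨ht, htM⟩).trans (le_max_left _ _)) (lt_add_one T')

/-- Uniqueness of the leg turns crossings into times on one line; `Q` carries the sign condition, so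
both kinds of crossings are covered. -/
lemma crossings_eq_image {K M : Set Space} {o s p d : Space} {n : ℕ} (hl : Leg K o s n p d)
    (Q : Space → Space → Prop) :
    {x | x ∈ M ∧ ∃ d, PassesAt K o s n x d ∧ Q x d} =
      (fun t : ℝ => p + t • d) '' {t | t ∈ freeTimes K p d ∧ p + t • d ∈ M ∧ Q (p + t • d) d} := by
  ext x
  constructor
  · rintro ⟨hx, d', ⟨p', hl', t, ht, rfl, hfree⟩, hQ⟩
    obtain ⟨rfl, rfl⟩ := hl.unique hl'
    exact ⟨t, ⟨⟨ht, hfree⟩, hx, hQ⟩, rfl⟩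
  · rintro ⟨t, ⟨ht, hM, hQ⟩, rfl⟩
    exact ⟨hM, d, ⟨p, hl, t, ht.1, rfl, ht.2⟩, hQ⟩

/-- A generic segment of a ray leaves a closed surface as often as it enters it. -/
lemma IsGenericRay.encard_eq_of_outward {K M : Set Space} (hK : IsClosed K) (hM : IsClosed M)
    (hKext : K ⊆ exterior M) {o : Space} {n : ℕ} (hn : n = 0 → o ∈ exterior M)
    {m : Space → Space} (hm : ∀ x ∈ regularPart M, IsOutwardNormal M x (m x)) {s : Space}
    (hs0 : s ≠ 0) (hs : IsGenericRay K o n M s) :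
    (posCrossings K o m n M s).encard = (negCrossings K o m n M s).encard := by
  classical
  by_cases hleg : ∃ p d, Leg K o s n p d
  swap
  · have h1 : posCrossings K o m n M s = ∅ := eq_empty_of_forall_notMem fun x hx => by
      obtain ⟨-, d, ⟨p, hl, -⟩, -⟩ := hx
      exact hleg ⟨p, d, hl⟩
    have h2 : negCrossings K o m n M s = ∅ := eq_empty_of_forall_notMem fun x hx => by
      obtain ⟨-, d, ⟨p, hl, -⟩, -⟩ := hx
      exact hleg ⟨p, d, hl⟩
    rw [h1, h2]
  obtain ⟨p, d, hl⟩ := hleg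
  have hd : d ≠ 0 := by
    rw [← norm_pos_iff, hl.norm_direction]
    exact norm_pos_iff.2 hs0
  have hc : Continuous fun u : ℝ => p + u • d := by fun_prop
  have hinj : Function.Injective fun u : ℝ => p + u • d := fun u v huv =>
    smul_left_injective ℝ hd (add_left_cancel huv)
  have hpass : ∀ t ∈ freeTimes K p d, PassesAt K o s n (p + t • d) d := fun t ht =>
    ⟨p, hl, t, ht.1, rfl, ht.2⟩
  have hfin : {t | t ∈ freeTimes K p d ∧ p + t • d ∈ M}.Finite := by
    refine Finite.of_finite_image (f := fun u : ℝ => p + u • d) (hs.finite.subset ?_) hinj.injOn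
    rintro _ ⟨t, ⟨ht, htM⟩, rfl⟩
    exact ⟨htM, d, hpass t ht⟩
  have hout : ∀ t ∈ freeTimes K p d, p + t • d ∈ M →
      IsOutwardNormal M (p + t • d) (m (p + t • d)) := fun t ht htM =>
    hm _ (hs.regular ⟨htM, d, hpass t ht⟩)
  have hPf : {t | t ∈ freeTimes K p d ∧ p + t • d ∈ M ∧ 0 < inner ℝ d (m (p + t • d))}.Finite :=
    hfin.subset fun t ht => ⟨ht.1, ht.2.1⟩
  have hNf : {t | t ∈ freeTimes K p d ∧ p + t • d ∈ M ∧ inner ℝ d (m (p + t • d)) < 0}.Finite :=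
    hfin.subset fun t ht => ⟨ht.1, ht.2.1⟩
  have e1 : posCrossings K o m n M s = _ := crossings_eq_image hl fun x d => 0 < inner ℝ d (m x)
  have e2 : negCrossings K o m n M s = _ := crossings_eq_image hl fun x d => inner ℝ d (m x) < 0
  rw [e1, e2, hinj.encard_image, hinj.encard_image, hPf.encard_eq_coe_toFinset_card,
    hNf.encard_eq_coe_toFinset_card]
  congr 1
  -- Without crossings both counts vanish. Otherwise a crossing time `t₁` ensures that there are
  -- free times from which to choose exterior points before the first and after the last crossing.
  rcases {t | t ∈ freeTimes K p d ∧ p + t • d ∈ M}.eq_empty_or_nonempty with hemp | ⟨t₁, ht₁, -⟩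
  · have hno : ∀ t ∈ freeTimes K p d, p + t • d ∉ M := fun t ht htM =>
      (hemp ▸ (⟨ht, htM⟩ : t ∈ {t | t ∈ freeTimes K p d ∧ p + t • d ∈ M}) : t ∈ (∅ : Set ℝ))
    congr 1
    ext t
    simp only [Finite.mem_toFinset, mem_ofPred_eq]
    exact ⟨fun h => absurd h.2.1 (hno t h.1), fun h => absurd h.2.1 (hno t h.1)⟩
  have hpext : p ∈ exterior M := by
    rcases hl.start_mem with ⟨h0, rfl⟩ | h
    · exact hn h0
    · exact hKext h
  obtain ⟨a, haJ, hae, haC⟩ : ∃ a ∈ freeTimes K p d, p + a • d ∈ exterior M ∧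
      ∀ t ∈ freeTimes K p d, p + t • d ∈ M → a < t := by
    have h1 : ∀ᶠ u in 𝓝[>] (0 : ℝ), p + u • d ∈ exterior M := nhdsWithin_le_nhds
      (hc.continuousAt.eventually ((isOpen_exterior hM).mem_nhds (by simpa using hpext)))
    have h2 : ∀ᶠ u in 𝓝[>] (0 : ℝ), ∀ t ∈ {t | t ∈ freeTimes K p d ∧ p + t • d ∈ M}, u < t :=
      (Filter.eventually_all_finite hfin).2 fun t ht => nhdsWithin_le_nhds (gt_mem_nhds ht.1.1)
    obtain ⟨a, ha1, ha2, ha3⟩ := (h1.and (h2.and (Ioo_mem_nhdsGT ht₁.1))).exists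
    exact ⟨a, mem_freeTimes_of_le ht₁ ha3.1 ha3.2.le, ha1, fun t ht htM => ha2 t ⟨ht, htM⟩⟩
  obtain ⟨b, hbJ, hbe, hbC⟩ := exists_late_exterior_time hK hM hKext hd ht₁ hfin
  have hshift : ∀ t : ℝ, Filter.Tendsto (fun u => u - t) (𝓝[>] t) (𝓝[>] 0) ∧
      Filter.Tendsto (fun u => u - t) (𝓝[<] t) (𝓝[<] 0) := by
    intro t
    have hct : Filter.Tendsto (fun u : ℝ => u - t) (𝓝 t) (𝓝 0) := by
      have : Continuous fun u : ℝ => u - t := by fun_prop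
      simpa using this.tendsto t
    constructor
    · exact tendsto_nhdsWithin_iff.2 ⟨hct.mono_left nhdsWithin_le_nhds,
        eventually_nhdsWithin_of_forall fun u hu => sub_pos.2 (mem_Ioi.1 hu)⟩
    · exact tendsto_nhdsWithin_iff.2 ⟨hct.mono_left nhdsWithin_le_nhds,
        eventually_nhdsWithin_of_forall fun u hu => sub_neg.2 (mem_Iio.1 hu)⟩
  have hadd : ∀ t u : ℝ, p + t • d + (u - t) • d = p + u • d := fun t u => by module
  have hnotM : ∀ t, p + t • d ∈ M → t ∉ {t : ℝ | p + t • d ∈ exterior M} := fun t ht he =>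
    exterior_subset_compl M he ht
  refine card_entries_eq_card_exits (e := {t : ℝ | p + t • d ∈ exterior M})
    (isPreconnected_freeTimes K p d) _ _ ?_ ?_ ?_ haJ hbJ hae hbe ?_ ?_ ?_ ?_
  · intro t ht
    simp only [Finite.mem_toFinset, mem_ofPred_eq] at ht
    obtain ⟨h1, h2⟩ := (hout t ht.1 ht.2.1).sides ht.2.1 ht.2.2
    refine ⟨hnotM t ht.2.1, ?_, ?_⟩
    · exact ((hshift t).2.eventually h2).mono fun u hu => by rw [hadd] at hu; exact hu.2
    · exact ((hshift t).1.eventually h1).mono fun u hu => by rw [hadd] at hu; exact hu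
  · intro t ht
    simp only [Finite.mem_toFinset, mem_ofPred_eq] at ht
    obtain ⟨h1, h2⟩ := (hout t ht.1 ht.2.1).sides_of_neg ht.2.1 ht.2.2
    refine ⟨hnotM t ht.2.1, ?_, ?_⟩
    · exact ((hshift t).2.eventually h2).mono fun u hu => by rw [hadd] at hu; exact hu
    · exact ((hshift t).1.eventually h1).mono fun u hu => by rw [hadd] at hu; exact hu.2
  · intro t ht htP htN
    simp only [Finite.mem_toFinset, mem_ofPred_eq] at htP htN
    have htM : p + t • d ∉ M := fun htM => by
      rcases lt_or_gt_of_ne ((hout t ht htM).inner_ne_zero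
        (hs.transversal _ htM d (hpass t ht))) with h | h
      · exact htN ⟨ht, htM, h⟩
      · exact htP ⟨ht, htM, h⟩
    by_cases he : p + t • d ∈ exterior M
    · exact Or.inl (hc.continuousAt.eventually ((isOpen_exterior hM).mem_nhds he))
    · exact Or.inr ((hc.continuousAt.eventually
        ((isOpen_compl_diff_exterior hM).mem_nhds ⟨htM, he⟩)).mono fun u hu => hu.2)
  all_goals
    intro t ht
    simp only [Finite.mem_toFinset, mem_ofPred_eq] at ht
  · exact haC t ht.1 ht.2.1
  · exact haC t ht.1 ht.2.1
  · exact hbC t ht.1 ht.2.1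
  · exact hbC t ht.1 ht.2.1

/-! ### Semicontinuity of the number of crossings -/

/-- Points of the ray just before and just after `x` lie in the open sets `A` and `B`. A nearby ray
is still in `A` and `B` at the same times, so it meets `M` in between, and convexity of a ball keeps
this crossing in `U`. `A` and `B` are the two sides of `M`, in either order. -/
lemma eventually_crossings_inter_nonempty {K M : Set Space} (hK : IsClosed K) {o : Space}
    (ho : o ∉ K) {n : ℕ} {s₀ x d : Space} (hd : PassesAt K o s₀ n x d) {A B : Set Space}
    (hA : IsOpen A) (hB : IsOpen B)
    (hAB : ∀ C : Set Space, IsPreconnected C → (C ∩ A).Nonempty → (C ∩ B).Nonempty →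
      (C ∩ M).Nonempty)
    (hxA : ∀ᶠ t : ℝ in 𝓝[<] 0, x + t • d ∈ A) (hxB : ∀ᶠ t : ℝ in 𝓝[>] 0, x + t • d ∈ B)
    {U : Set Space} (hU : U ∈ 𝓝 x) :
    ∀ᶠ s in 𝓝 s₀, (crossings K o n M s ∩ U).Nonempty := by
  obtain ⟨p, hl, t₀, ht₀, rfl, hfree⟩ := hd
  obtain ⟨ε, hε, hεU⟩ := Metric.mem_nhds_iff.1 hU
  have hc : Continuous fun u : ℝ => p + t₀ • d + u • d := by fun_prop
  have hball : ∀ᶠ u : ℝ in 𝓝 0, p + t₀ • d + u • d ∈ Metric.ball (p + t₀ • d) ε :=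
    hc.continuousAt.eventually (Metric.isOpen_ball.mem_nhds (by simpa using hε))
  obtain ⟨T, hTt, hTfree⟩ : ∃ T, t₀ < T ∧ T ∈ freeTimes K p d := by
    obtain ⟨T, h1, h2⟩ := ((((isOpen_freeTimes hK p d).eventually_mem ⟨ht₀, hfree⟩).filter_mono
      (nhdsWithin_le_nhds (s := Ioi t₀))).and self_mem_nhdsWithin).exists
    exact ⟨T, h2, h1⟩
  obtain ⟨u, huA, hub, hu⟩ := (hxA.and ((hball.filter_mono nhdsWithin_le_nhds).and
    (Ioo_mem_nhdsLT (neg_lt_zero.2 ht₀)))).exists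
  obtain ⟨v, hvB, hvb, hv⟩ := (hxB.and ((hball.filter_mono nhdsWithin_le_nhds).and
    (Ioo_mem_nhdsGT (sub_pos.2 hTt)))).exists
  obtain ⟨P, D, hP, hD, rfl, rfl, hstart, hleg⟩ := hl.exists_continuous hK ho
  have hfr := eventually_forall_notMem hstart (T := fun _ => T) continuousAt_const
    (lt_add_one T) fun u₀ hu₀ => (eventually_notMem_of_notMem hK hP hD
      (hTfree.2 u₀ hu₀)).mono fun z hz _ => hz
  have hcont : ∀ w : ℝ, Filter.Tendsto (fun s => P s + (t₀ + w) • D s) (𝓝 s₀)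
      (𝓝 (P s₀ + t₀ • D s₀ + w • D s₀)) := by
    intro w
    have h1 : ContinuousAt (fun s => P s + (t₀ + w) • D s) s₀ :=
      hP.add (hD.const_smul (t₀ + w))
    have h2 := h1.tendsto
    rwa [add_smul, ← add_assoc] at h2
  filter_upwards [hleg, hfr, (hcont u).eventually (hA.mem_nhds huA),
    (hcont u).eventually (Metric.isOpen_ball.mem_nhds hub),
    (hcont v).eventually (hB.mem_nhds hvB),
    (hcont v).eventually (Metric.isOpen_ball.mem_nhds hvb)] with s h1 h2 h3 h4 h5 h6
  obtain ⟨y, hyC, hyM⟩ := hAB (segment ℝ (P s + (t₀ + u) • D s) (P s + (t₀ + v) • D s))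
    (convex_segment _ _).isPreconnected ⟨_, left_mem_segment _ _ _, h3⟩
    ⟨_, right_mem_segment _ _ _, h5⟩
  have hyU := hεU ((convex_ball _ _).segment_subset h4 h6 hyC)
  rw [segment_eq_image'] at hyC
  obtain ⟨θ, hθ, rfl⟩ := hyC
  refine ⟨_, ⟨hyM, D s, P s, h1, t₀ + u + θ * (v - u), ?_, by module, fun w hw => h2 w hw.1 ?_⟩, hyU⟩
  · have : 0 ≤ θ * (v - u) := mul_nonneg hθ.1 (by linarith [hu.2, hv.1])
    linarith [hu.1]
  · have : θ * (v - u) ≤ v - u := mul_le_of_le_one_left (by linarith [hu.2, hv.1]) hθ.2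
    linarith [hw.2, hv.2]

/-- The number of crossings cannot drop near a generic direction. -/
lemma IsGenericRay.eventually_encard_le {K M : Set Space} (hK : IsClosed K) (hM : IsClosed M)
    {o : Space} (ho : o ∉ K) {n : ℕ} {m : Space → Space}
    (hm : ∀ x ∈ regularPart M, IsOutwardNormal M x (m x)) {s₀ : Space}
    (hs : IsGenericRay K o n M s₀) :
    ∀ᶠ s in 𝓝 s₀, (crossings K o n M s₀).encard ≤ (crossings K o n M s).encard := by
  obtain ⟨U, hU, hdisj⟩ := hs.finite.t2_separation
  have hsep := fun C (hC : IsPreconnected C) => inter_nonempty_of_isPreconnected hM hC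
  have hev : ∀ᶠ s in 𝓝 s₀, ∀ x ∈ crossings K o n M s₀, (crossings K o n M s ∩ U x).Nonempty := by
    rw [Filter.eventually_all_finite hs.finite]
    intro x hx
    have hUx : U x ∈ 𝓝 x := (hU x).2.mem_nhds (hU x).1
    obtain ⟨hxM, d, hd⟩ := hx
    have hout := hm x (hs.regular ⟨hxM, d, hd⟩)
    rcases lt_or_gt_of_ne (hout.inner_ne_zero (hs.transversal x hxM d hd)) with h | h
    · obtain ⟨h1, h2⟩ := hout.sides_of_neg hxM h
      exact eventually_crossings_inter_nonempty hK ho hd (isOpen_exterior hM)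
        (isOpen_compl_diff_exterior hM) hsep h2 h1 hUx
    · obtain ⟨h1, h2⟩ := hout.sides hxM h
      exact eventually_crossings_inter_nonempty hK ho hd (isOpen_compl_diff_exterior hM)
        (isOpen_exterior hM) (fun C hC h3 h4 => hsep C hC h4 h3) h2 h1 hUx
  filter_upwards [hev] with s hs'
  -- Disjoint neighbourhoods of the old crossings make the choice of new crossings injective.
  choose! y hy using hs'
  refine encard_le_encard_of_injOn (f := y) (fun x hx => (hy x hx).1) fun x hx x' hx' hxx' => ?_
  by_contra hne
  exact (hdisj hx hx' hne).le_bot ⟨(hy x hx).2, hxx' ▸ (hy x' hx').2⟩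

/-! ### Integrating the number of points of a family of sets -/

/-- The cell of the grid of mesh `1 / j` containing `x`. -/
def gridCell (j : ℕ) (x : Space) : Fin 3 → ℤ := fun i => ⌊(j : ℝ) * x i⌋

lemma measurable_gridCell (j : ℕ) : Measurable (gridCell j) :=
  measurable_pi_lambda _ fun i => Int.measurable_floor.comp (by fun_prop)

lemma eventually_gridCell_ne {x y : Space} (h : x ≠ y) :
    ∀ᶠ j in Filter.atTop, gridCell j x ≠ gridCell j y := by
  obtain ⟨i, hi⟩ : ∃ i, x i ≠ y i := by
    by_contra! hn
    exact h (by ext i; exact hn i)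
  have hpos : 0 < |x i - y i| := abs_pos.2 (sub_ne_zero.2 hi)
  filter_upwards [Filter.eventually_ge_atTop ⌈|x i - y i|⁻¹⌉₊] with j hj heq
  have h1 := Int.abs_sub_lt_one_of_floor_eq_floor (congrFun heq i)
  rw [← mul_sub, abs_mul, Nat.abs_cast] at h1
  have h2 : |x i - y i|⁻¹ ≤ j := Nat.ceil_le.1 hj
  rw [inv_le_iff_one_le_mul₀ hpos] at h2
  linarith

lemma natCast_le_tsum_indicator {Y : Type*} (X : Y → Set Space) (T : (Fin 3 → ℤ) → Set Y) (j : ℕ)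
    (hT : ∀ z, {y | (X y ∩ gridCell j ⁻¹' {z}).Nonempty} ⊆ T z) (y : Y) (F : Finset Space)
    (hF : (F : Set Space) ⊆ X y) (hinj : ∀ x ∈ F, ∀ x' ∈ F, x ≠ x' → gridCell j x ≠ gridCell j x') :
    (F.card : ℝ≥0∞) ≤ ∑' z, (T z).indicator 1 y := by
  classical
  have hcard : (F.image (gridCell j)).card = F.card :=
    Finset.card_image_of_injOn fun x hx x' hx' h => by
      by_contra hne
      exact hinj x hx x' hx' hne h
  calc (F.card : ℝ≥0∞) = ∑ z ∈ F.image (gridCell j), 1 := by simp [hcard]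
    _ ≤ ∑ z ∈ F.image (gridCell j), (T z).indicator 1 y := by
      refine Finset.sum_le_sum fun z hz => ?_
      obtain ⟨x, hx, rfl⟩ := Finset.mem_image.1 hz
      rw [indicator_of_mem (hT _ ⟨x, hF hx, rfl⟩)]
      rfl
    _ ≤ _ := ENNReal.sum_le_tsum _

/-- If the set of parameters `y` for which `X y` meets `A` is controlled by `ν A`, then the
number of points of `X y` has a measurable majorant with integral at most `ν univ`. -/
lemma exists_measurable_majorant_encard {Y : Type*} [MeasurableSpace Y] (μ : Measure Y)
    (X : Y → Set Space) (ν : Measure Space)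
    (h : ∀ A, MeasurableSet A → μ {y | (X y ∩ A).Nonempty} ≤ ν A) :
    ∃ H : Y → ℝ≥0∞, Measurable H ∧ ∫⁻ y, H y ∂μ ≤ ν univ ∧ ∀ y, ((X y).encard : ℝ≥0∞) ≤ H y := by
  -- The sets of parameters meeting a cell need not be measurable, so they are replaced by
  -- measurable hulls of the same measure.
  set T : ℕ → (Fin 3 → ℤ) → Set Y := fun j z =>
    toMeasurable μ {y | (X y ∩ gridCell j ⁻¹' {z}).Nonempty} with hT
  have hTm : ∀ j z, MeasurableSet (T j z) := fun j z => measurableSet_toMeasurable _ _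
  have hm : ∀ j, Measurable fun y => ∑' z, (T j z).indicator (1 : Y → ℝ≥0∞) y := fun j =>
    Measurable.tsum fun z => measurable_one.indicator (hTm j z)
  -- For each mesh, count the cells met by `X y`. Any finite subset of `X y` is eventually separated
  -- by the grid, so the lower limit dominates the number of points, while Fatou's lemma bounds its
  -- integral.
  refine ⟨fun y => Filter.liminf (fun j => ∑' z, (T j z).indicator (1 : Y → ℝ≥0∞) y) Filter.atTop,
    .liminf hm, ?_, fun y => ?_⟩
  · refine (lintegral_liminf_le hm).trans ?_
    refine Filter.liminf_le_of_le (by isBoundedDefault) fun b hb => ?_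
    obtain ⟨j, hj⟩ := hb.exists
    refine hj.trans ?_
    rw [lintegral_tsum fun z => (measurable_one.indicator (hTm j z)).aemeasurable]
    have hQ : ∀ z, MeasurableSet (gridCell j ⁻¹' {z}) := fun z =>
      measurable_gridCell j (measurableSet_singleton z)
    calc ∑' z, ∫⁻ y, (T j z).indicator 1 y ∂μ ≤ ∑' z, ν (gridCell j ⁻¹' {z}) := by
          refine ENNReal.tsum_le_tsum fun z => ?_
          rw [lintegral_indicator_one (hTm j z), hT, measure_toMeasurable]
          exact h _ (hQ z)
      _ = ν (⋃ z, gridCell j ⁻¹' {z}) := by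
          refine (measure_iUnion (fun z z' hne => ?_) hQ).symm
          exact Disjoint.preimage _ (disjoint_singleton.2 hne)
      _ ≤ ν univ := measure_mono (subset_univ _)
  · have key : ∀ F : Finset Space, (F : Set Space) ⊆ X y → (F.card : ℝ≥0∞) ≤
        Filter.liminf (fun j => ∑' z, (T j z).indicator (1 : Y → ℝ≥0∞) y) Filter.atTop := by
      intro F hF
      refine Filter.le_liminf_of_le (by isBoundedDefault) ?_
      have hev : ∀ᶠ j in Filter.atTop, ∀ x ∈ F, ∀ x' ∈ F, x ≠ x' →
          gridCell j x ≠ gridCell j x' := by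
        rw [Filter.eventually_all_finset]
        intro x _
        rw [Filter.eventually_all_finset]
        intro x' _
        by_cases hne : x = x'
        · exact Filter.Eventually.of_forall fun j h => absurd hne h
        · exact (eventually_gridCell_ne hne).mono fun j hj _ => hj
      filter_upwards [hev] with j hj
      exact natCast_le_tsum_indicator X (T j) j (fun z => subset_toMeasurable _ _) y F hF hj
    by_cases hfin : (X y).Finite
    · rw [hfin.encard_eq_coe_toFinset_card]
      simpa using key hfin.toFinset (by simp)
    · have htop : ∀ k : ℕ, (k : ℝ≥0∞) ≤
          Filter.liminf (fun j => ∑' z, (T j z).indicator (1 : Y → ℝ≥0∞) y) Filter.atTop := by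
        intro k
        obtain ⟨F, hF, hk⟩ := Set.Infinite.exists_subset_card_eq hfin k
        exact hk ▸ key F hF
      exact le_top.trans_eq (ENNReal.eq_top_of_forall_nnreal_le fun r => by
        obtain ⟨k, hk⟩ := exists_nat_ge r
        exact le_trans (by exact_mod_cast hk) (htop k)).symm

/-! ### Fluxes through a closed surface -/

/-- A Crofton-type inequality: the mean number of crossings is at most a constant times the area. -/
lemma exists_majorant_crossings {K M : Set Space} (hK : IsUrbanSolid K)
    (hM : IsClosedSurface M) (hMK : M ⊆ Kᶜ) {o : Space} {n : ℕ} (hn : n = 0 → o ∉ M) :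
    ∃ H : Directions → ℝ≥0∞, Measurable H ∧ ∫⁻ s, H s ∂uniformMeasure ≠ ∞ ∧
      ∀ s : Directions, ((crossings K o n M s).encard : ℝ≥0∞) ≤ H s := by
  obtain ⟨C, hC, h⟩ := exists_uniformMeasure_crossings_le hK hM.compact hMK hn
  obtain ⟨H, hHm, hH, hle⟩ := exists_measurable_majorant_encard uniformMeasure
    (fun s : Directions => crossings K o n M s)
    (C • (Measure.hausdorffMeasure 2).restrict M) fun A hA => by
      rw [Measure.smul_apply, smul_eq_mul, Measure.restrict_apply hA, inter_comm]
      exact h A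
  refine ⟨H, hHm, (hH.trans_lt ?_).ne, hle⟩
  rw [Measure.smul_apply, smul_eq_mul, Measure.restrict_apply_univ]
  exact ENNReal.mul_lt_top hC.lt_top hM.finite_area

lemma ae_isGenericRay {K M : Set Space} (hK : IsUrbanSolid K)
    (hM : IsClosedSurface M) (hMK : M ⊆ Kᶜ) {o : Space} {n : ℕ} (hn : n = 0 → o ∉ M) :
    ∀ᵐ s : Directions ∂uniformMeasure, IsGenericRay K o n M s := by
  obtain ⟨H, hHm, hH, hle⟩ := exists_majorant_crossings hK hM hMK hn
  filter_upwards [ae_lt_top hHm hH, ae_crossings_subset_regularPart hK hM hMK hn,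
    ae_crossings_transversal hK hM.compact hMK hn] with s h1 h2 h3
  refine ⟨?_, h2, h3⟩
  rw [← encard_lt_top_iff]
  exact ENat.toENNReal_lt_top.1 ((hle s).trans_lt h1)

/-- By semicontinuity every generic direction in this set is interior to it, so the set agrees
almost everywhere with its open interior. -/
lemma nullMeasurableSet_le_encard_crossings {K M : Set Space} (hK : IsClosed K) (hM : IsClosed M)
    {o : Space} (ho : o ∉ K) {n : ℕ} {m : Space → Space}
    (hm : ∀ x ∈ regularPart M, IsOutwardNormal M x (m x))
    (hgen : ∀ᵐ s : Directions ∂uniformMeasure, IsGenericRay K o n M s) (k : ℕ∞) :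
    NullMeasurableSet {s : Directions | k ≤ (crossings K o n M s).encard} uniformMeasure := by
  refine NullMeasurableSet.congr (s := interior {s : Directions | k ≤ (crossings K o n M s).encard})
    isOpen_interior.measurableSet.nullMeasurableSet ?_
  filter_upwards [hgen] with s hs
  refine propext (show s ∈ interior _ ↔ s ∈ {s : Directions | k ≤ (crossings K o n M s).encard} from
    ⟨fun h => interior_subset h, fun h => ?_⟩)
  refine mem_interior_iff_mem_nhds.2 ?_
  filter_upwards [continuous_subtype_val.continuousAt.eventually
    (hs.eventually_encard_le hK hM ho hm)] with s' hs'
  exact le_trans h hs'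

lemma nullMeasurableSet_encard_crossings_eq {K M : Set Space} (hK : IsClosed K) (hM : IsClosed M)
    {o : Space} (ho : o ∉ K) {n : ℕ} {m : Space → Space}
    (hm : ∀ x ∈ regularPart M, IsOutwardNormal M x (m x))
    (hgen : ∀ᵐ s : Directions ∂uniformMeasure, IsGenericRay K o n M s) (k : ℕ∞) :
    NullMeasurableSet {s : Directions | (crossings K o n M s).encard = k} uniformMeasure := by
  have h := nullMeasurableSet_le_encard_crossings hK hM ho hm hgen
  by_cases hk : k = ⊤
  · convert h k using 3
    rw [hk, top_le_iff]
  · convert (h k).diff (h (k + 1)) using 1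
    ext s
    simp only [mem_ofPred_eq, mem_sdiff, ENat.add_one_le_iff hk, not_lt]
    exact ⟨fun h => ⟨h.ge, h.le⟩, fun h => le_antisymm h.2 h.1⟩

lemma IsGenericRay.encard_crossings {K M : Set Space} {o : Space} {n : ℕ}
    {m : Space → Space} (hm : ∀ x ∈ regularPart M, IsOutwardNormal M x (m x)) {s : Space}
    (hs : IsGenericRay K o n M s) :
    (crossings K o n M s).encard =
      (posCrossings K o m n M s).encard + (negCrossings K o m n M s).encard := by
  have hunion : crossings K o n M s = posCrossings K o m n M s ∪ negCrossings K o m n M s := by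
    ext x
    constructor
    · rintro ⟨hx, d, hd⟩
      rcases lt_or_gt_of_ne ((hm x (hs.regular ⟨hx, d, hd⟩)).inner_ne_zero
        (hs.transversal x hx d hd)) with h | h
      · exact Or.inr ⟨hx, d, hd, h⟩
      · exact Or.inl ⟨hx, d, hd, h⟩
    · rintro (⟨hx, d, hd, -⟩ | ⟨hx, d, hd, -⟩) <;> exact ⟨hx, d, hd⟩
  rw [hunion, encard_union_eq]
  refine disjoint_left.2 ?_
  rintro x ⟨-, d, ⟨p, hl, -⟩, h1⟩ ⟨-, d', ⟨p', hl', -⟩, h2⟩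
  obtain ⟨-, rfl⟩ := hl.unique hl'
  exact lt_asymm h1 h2

/-- The conclusions of the flux theorem for an outward normal field. -/
lemma flux_of_outward {K : Set Space} (hK : IsUrbanSolid K) {o : Space} (ho : o ∉ K)
    {M : Set Space} (hM : IsClosedSurface M) (hMK : M ⊆ Kᶜ) {m : Space → Space}
    (hm : ∀ x ∈ regularPart M, IsOutwardNormal M x (m x)) {S : Set Directions} (hS : IsOpen S)
    {n : ℕ} (hn : n = 0 → o ∈ exterior M) :
    (∀ᵐ s : Directions ∂uniformMeasure,
      (posCrossings K o m n M s).encard = (negCrossings K o m n M s).encard) ∧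
      posFlux K o m n S M ≠ ∞ ∧ posFlux K o m n S M = negFlux K o m n S M := by
  have hMc : IsClosed M := hM.compact.isClosed
  have hn' : n = 0 → o ∉ M := fun h => exterior_subset_compl M (hn h)
  have hKext : K ⊆ exterior M := subset_exterior_of_isPreconnected hK.connected.isPreconnected
    (fun x hx hxM => hMK hxM hx) hK.unbounded
  have hgen := ae_isGenericRay hK hM hMK hn'
  have hae : ∀ᵐ s : Directions ∂uniformMeasure,
      (posCrossings K o m n M s).encard = (negCrossings K o m n M s).encard := by
    filter_upwards [hgen] with s hs
    exact hs.encard_eq_of_outward hK.isClosed hMc hKext hn hm (ne_zero_of_mem_unit_sphere s)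
  refine ⟨hae, ?_, ?_⟩
  · obtain ⟨H, hHm, hH, hle⟩ := exists_majorant_crossings hK hM hMK hn'
    -- Semicontinuity concerns the total number of crossings. Almost everywhere this total is finite
    -- and twice the number of positive ones, so `k` positive crossings means `k + k` crossings.
    have hnull : ∀ k : ℕ∞, NullMeasurableSet
        {s : Directions | s ∈ S ∧ (posCrossings K o m n M s).encard = k} uniformMeasure := by
      intro k
      refine hS.measurableSet.nullMeasurableSet.inter
        (NullMeasurableSet.congr (nullMeasurableSet_encard_crossings_eq hK.isClosed hMc ho hm
          hgen (k + k)) ?_)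
      filter_upwards [hgen, hae] with s hs hse
      have h1 := hs.encard_crossings hm
      rw [← hse] at h1
      have hfin := encard_ne_top_iff.2 hs.finite
      refine propext (show _ = _ ↔ _ = _ from ?_)
      rw [h1] at hfin ⊢
      generalize (posCrossings K o m n M s).encard = a at hfin ⊢
      induction a using ENat.recTopCoe with
      | top => simp at hfin
      | coe a =>
        induction k using ENat.recTopCoe with
        | top => exact iff_of_false hfin (ENat.natCast_ne_top a)
        | coe k =>
          norm_cast
          omega
    refine ne_top_of_le_ne_top hH ?_
    calc posFlux K o m n S M = ∑' k : ℕ∞, ∫⁻ s,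
          {s : Directions | s ∈ S ∧ (posCrossings K o m n M s).encard = k}.indicator
            (fun _ => (k : ℝ≥0∞)) s ∂uniformMeasure := by
          refine tsum_congr fun k => ?_
          rw [lintegral_indicator_const₀ (hnull k)]
      _ = ∫⁻ s, ∑' k : ℕ∞, {s : Directions | s ∈ S ∧
          (posCrossings K o m n M s).encard = k}.indicator (fun _ => (k : ℝ≥0∞)) s
            ∂uniformMeasure :=
          (lintegral_tsum fun k => aemeasurable_const.indicator₀ (hnull k)).symm
      _ ≤ ∫⁻ s, H s ∂uniformMeasure := by
          refine lintegral_mono fun s => ?_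
          -- For a fixed direction only the term with `k` equal to the actual count can be nonzero,
          -- and this count is at most the majorant `H s`.
          rw [tsum_eq_single (posCrossings K o m n M s).encard fun k hk =>
            indicator_of_notMem (fun h => hk h.2.symm) _]
          refine (indicator_le_self' (fun _ _ => zero_le) s).trans (le_trans ?_ (hle s))
          refine ENat.toENNReal_le.2 (encard_le_encard ?_)
          rintro x ⟨hx, d, hd, -⟩
          exact ⟨hx, d, hd⟩
  · refine tsum_congr fun k => ?_
    congr 1
    refine measure_congr ?_
    filter_upwards [hae] with s hs
    exact propext (show (_ ∧ _ = _) ↔ (_ ∧ _ = _) by rw [hs])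

lemma posCrossings_neg (K : Set Space) (o : Space) (m : Space → Space) (n : ℕ) (A : Set Space)
    (s : Space) : posCrossings K o (fun x => -m x) n A s = negCrossings K o m n A s := by
  simp only [posCrossings, negCrossings, inner_neg_right, Left.neg_pos_iff]

lemma negCrossings_neg (K : Set Space) (o : Space) (m : Space → Space) (n : ℕ) (A : Set Space)
    (s : Space) : negCrossings K o (fun x => -m x) n A s = posCrossings K o m n A s := by
  simp only [posCrossings, negCrossings, inner_neg_right, Left.neg_neg_iff]

end RayFlux

end

/-! ### The flux theorem for either orientation of the normal. -/

theorem mainTheorem6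
    (K : Set RayFlux.Space) (hK : RayFlux.IsUrbanSolid K)
    (o : RayFlux.Space) (ho : o ∉ K)
    (M : Set RayFlux.Space) (hM : RayFlux.IsClosedSurface M) (hMK : M ⊆ Kᶜ)
    (m : RayFlux.Space → RayFlux.Space) (hm : RayFlux.IsUnitNormalField M m)
    (S : Set RayFlux.Directions) (hS : IsOpen S)
    (n : ℕ) (hn : n = 0 → o ∈ RayFlux.exterior M) :
    (∀ᵐ s : RayFlux.Directions ∂(RayFlux.uniformMeasure),
      (RayFlux.posCrossings K o m n M (s : RayFlux.Space)).encard =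
        (RayFlux.negCrossings K o m n M (s : RayFlux.Space)).encard) ∧
    RayFlux.posFlux K o m n S M ≠ ∞ ∧ RayFlux.negFlux K o m n S M ≠ ∞ ∧
    RayFlux.signedFlux K o m n S M = 0 := by
  rcases hm with hm | hm
  · obtain ⟨h1, h2, h3⟩ := RayFlux.flux_of_outward hK ho hM hMK hm hS hn
    exact ⟨h1, h2, h3 ▸ h2, by rw [RayFlux.signedFlux, h3, sub_self]⟩
  -- For an inward field, `-m` is outward, and changing the sign of the normal exchanges the two
  -- one-sided fluxes.
  · obtain ⟨h1, h2, h3⟩ := RayFlux.flux_of_outward hK ho hM hMK (m := fun x => -m x) hm hS hn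
    have e1 : RayFlux.posFlux K o (fun x => -m x) n S M = RayFlux.negFlux K o m n S M := by
      simp only [RayFlux.posFlux, RayFlux.negFlux, RayFlux.posCrossings_neg]
    have e2 : RayFlux.negFlux K o (fun x => -m x) n S M = RayFlux.posFlux K o m n S M := by
      simp only [RayFlux.posFlux, RayFlux.negFlux, RayFlux.negCrossings_neg]
    simp only [RayFlux.posCrossings_neg, RayFlux.negCrossings_neg] at h1
    rw [e1] at h2
    rw [e1, e2] at h3
    exact ⟨h1.mono fun s hs => hs.symm, h3 ▸ h2, h2, by rw [RayFlux.signedFlux, h3, sub_self]⟩
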